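/- Let $S$ be a countable set, $\Delta\notin S$, and let $\mathbf X=(X_n)_{n\ge 0}$ be a Markov chain on $S\cup\{\Delta\}$ with transition function $p$, for which $\Delta$ is absorbing. Write $P_\mu,E_\mu$ for the law and expectation with initial distribution $\mu$, $P_x,E_x$ if $\mu=\delta_x$, $E[Z,A]=E[Z\mathbf 1_A]$, and $\tau_y=\inf\{n\ge 1: X_n=y\}$. Assume that the restriction of $p$ to $S$ is irreducible (for all $x,y\in S$ there is $n\ge 1$ with $P_x(X_n=y)>0$) and that $E_x[e^{\beta\tau_\Delta}]<\infty$ for some $\beta>0$ and some $x\in S$. Let $$\lambda_{cr}=\sup\{\lambda>0:\ E_x[e^{\lambda\tau_\Delta}]<\infty\text{ for some }x\in S\}.$$ A probability measure $\nu$ on $S$ is a quasistationary distribution (QSD) if $P_\nu(X_n\in\cdot\mid\tau_\Delta>n)=\nu$ for all $n\ge1$; its absorption parameter is the number $\lambda$ with $P_\nu(\tau_\Delta>n)=e^{-\lambda n}$ for all $n\ge 0$; a QSD with absorption parameter $\lambda_{cr}$ is called minimal. Suppose that $\lambda_{cr}$ is in the infinite MGF regime, i.e. $E_x[e^{\lambda_{cr}\tau_\Delta}]=\infty$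 for some $x\in S$. Then: 1. A minimal QSD exists if and only if $$E_x[\exp(\lambda_{cr}(\tau_\Delta\wedge\tau_x))]<\infty\quad\text{for some }x\in S.\qquad(\ast)$$ In this case the minimal QSD is unique and is given by $$\nu_{cr}(x)=\frac{e^{\lambda_{cr}}-1}{E_x[\exp(\lambda_{cr}\tau_\Delta),\tau_\Delta<\tau_x]},\qquad x\in S,$$ where the denominator lies in $(0,\infty)$ for every $x\in S$. 2. If, in addition to $(\ast)$, $E_x[\exp(\lambda_{cr}\tau_x)\,\tau_x,\ \tau_x<\tau_\Delta]<\infty$ for some $x\in S$, and $p$ is aperiodic on $S$ (for each $x\in S$, $\gcd\{n\ge1:P_x(X_n=x)>0\}=1$), then for every initial distribution $\mu$ with finite support in $S$, $$\lim_{n\to\infty}P_\mu(X_n\in A\mid\tau_\Delta>n)=\nu_{cr}(A)\quad\text{for every }A\subseteq S.$$ -/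

import Mathlib

open MeasureTheory ProbabilityTheory Filter Topology
open scoped ENNReal

namespace QSD

/-- The state space is `Option S`, the disjoint union of the countable set `S` (the states
`some x`) and the singleton `{Δ}` with `Δ = none`. It carries the discrete σ-algebra. -/
instance instMeasurableSpaceOption {S : Type*} : MeasurableSpace (Option S) := ⊤

/-- The transition function `p`, with `p x y` the probability to step from `x` to `y`,
as a Markov kernel. -/
noncomputable def stepKernel {S : Type*} (p : Option S → PMF (Option S)) :
    Kernel (Option S) (Option S) where
  toFun x := (p x).toMeasure
  measurable' := measurable_from_top

instance instIsMarkovKernelStepKernel {S : Type*} (p : Option S → PMF (Option S)) :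
    IsMarkovKernel (stepKernel p) :=
  ⟨fun x => PMF.toMeasure.isProbabilityMeasure (p x)⟩

/-- The law of `X_{n+1}` given the history `X_0, …, X_n`: one step of `p` from `X_n`. -/
noncomputable def historyKernel {S : Type*} (p : Option S → PMF (Option S)) (n : ℕ) :
    Kernel (∀ _ : Finset.Iic n, Option S) (Option S) :=
  (stepKernel p).comap (fun h => h ⟨n, Finset.mem_Iic.2 le_rfl⟩) (measurable_pi_apply _)

instance instIsMarkovKernelHistoryKernel {S : Type*} (p : Option S → PMF (Option S)) (n : ℕ) :
    IsMarkovKernel (historyKernel p n) :=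
  Kernel.IsMarkovKernel.comap _ _

/-- `P_μ`: the law on path space `ℕ → S ∪ {Δ}` of the Markov chain with transition function `p`
and initial distribution `μ`. The chain is the coordinate process, `X_n ω = ω n`. -/
noncomputable def pathLaw {S : Type*} (p : Option S → PMF (Option S)) (μ : PMF (Option S)) :
    Measure (ℕ → Option S) :=
  Kernel.trajMeasure (X := fun _ => Option S) μ.toMeasure (historyKernel p)

/-- `P_x` for a starting point `x ∈ S`. -/
noncomputable def pointLaw {S : Type*} (p : Option S → PMF (Option S)) (x : S) :
    Measure (ℕ → Option S) :=
  pathLaw p (PMF.pure (some x))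

/-- `P_μ` for an initial distribution `μ` on `S`. -/
noncomputable def initLaw {S : Type*} (p : Option S → PMF (Option S)) (μ : PMF S) :
    Measure (ℕ → Option S) :=
  pathLaw p (μ.map some)

/-- `τ_y = inf {n ≥ 1 : X_n = y}`, with value `∞` if there is no such `n`. -/
noncomputable def hitTime {S : Type*} (y : Option S) (ω : ℕ → Option S) : ℕ∞ :=
  ⨅ (n : ℕ) (_ : 1 ≤ n ∧ ω n = y), (n : ℕ∞)

/-- The absorption time `τ_Δ`. -/
noncomputable def absTime {S : Type*} (ω : ℕ → Option S) : ℕ∞ := hitTime none ω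

/-- `exp (l * t) ∈ [0, ∞]` for a real `l` and a possibly infinite time `t`. -/
noncomputable def expTime (l : ℝ) (t : ℕ∞) : ℝ≥0∞ :=
  EReal.exp ((l : EReal) * ((t : ℝ≥0∞) : EReal))

/-- The moment generating function `E_x[exp (l τ_Δ)] ∈ [0, ∞]` of the absorption time. -/
noncomputable def mgfAbs {S : Type*} (p : Option S → PMF (Option S)) (l : ℝ) (x : S) : ℝ≥0∞ :=
  ∫⁻ ω, expTime l (absTime ω) ∂(pointLaw p x)

/-- The restriction of `p` to `S` is irreducible: every `y ∈ S` is reached from every `x ∈ S`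
with positive probability in some positive number of steps. -/
def IsIrreducible {S : Type*} (p : Option S → PMF (Option S)) : Prop :=
  ∀ x y : S, ∃ n : ℕ, 1 ≤ n ∧ 0 < pointLaw p x {ω | ω n = some y}

/-- `p` is aperiodic: for each `x ∈ S` the only common divisor of the possible return times
`{n ≥ 1 : P_x (X_n = x) > 0}` is `1`. -/
def IsAperiodic {S : Type*} (p : Option S → PMF (Option S)) : Prop :=
  ∀ x : S, ∀ d : ℕ,
    (∀ n : ℕ, 1 ≤ n → 0 < pointLaw p x {ω | ω n = some x} → d ∣ n) → d = 1

/-- Some exponential moment of the absorption time is finite. -/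
def HasExpMoment {S : Type*} (p : Option S → PMF (Option S)) : Prop :=
  ∃ β : ℝ, 0 < β ∧ ∃ x : S, mgfAbs p β x < ∞

/-- The critical absorption parameter `λ_cr`. For an irreducible chain with a finite exponential
moment of the absorption time, the set is non-empty and bounded above. -/
noncomputable def critParam {S : Type*} (p : Option S → PMF (Option S)) : ℝ :=
  sSup {l : ℝ | 0 < l ∧ ∃ x : S, mgfAbs p l x < ∞}

/-- `λ_cr` is in the infinite MGF regime. -/
def InfiniteMGF {S : Type*} (p : Option S → PMF (Option S)) : Prop :=
  ∃ x : S, mgfAbs p (critParam p) x = ∞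

/-- The conditional law `P_μ (X_n ∈ · | τ_Δ > n)`. -/
noncomputable def condLaw {S : Type*} (p : Option S → PMF (Option S)) (μ : PMF S) (n : ℕ) :
    Measure (Option S) :=
  (cond (initLaw p μ) {ω | (n : ℕ∞) < absTime ω}).map (fun ω => ω n)

/-- The probability measure `ν` on `S` is a quasistationary distribution:
`P_ν (X_n ∈ · | τ_Δ > n) = ν` for all `n ≥ 1`. -/
def IsQSD {S : Type*} (p : Option S → PMF (Option S)) (ν : PMF S) : Prop :=
  ∀ n : ℕ, 1 ≤ n → condLaw p ν n = (ν.map some).toMeasure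

/-- `l` is the absorption parameter of `ν`: `P_ν (τ_Δ > n) = exp (-l n)` for all `n ≥ 0`. -/
def HasAbsParam {S : Type*} (p : Option S → PMF (Option S)) (ν : PMF S) (l : ℝ) : Prop :=
  ∀ n : ℕ, initLaw p ν {ω | (n : ℕ∞) < absTime ω} = ENNReal.ofReal (Real.exp (-l * n))

/-- A minimal QSD: a QSD with absorption parameter `λ_cr`. -/
def IsMinimalQSD {S : Type*} (p : Option S → PMF (Option S)) (ν : PMF S) : Prop :=
  IsQSD p ν ∧ HasAbsParam p ν (critParam p)

/-- `ν` is the quasi-limiting distribution from the initial law `μ`: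
`P_μ (X_n ∈ A | τ_Δ > n) → ν(A)` for every set `A` of states. -/
def IsQuasiLimiting {S : Type*} (p : Option S → PMF (Option S)) (μ ν : PMF S) : Prop :=
  ∀ A : Set (Option S),
    Tendsto (fun n : ℕ => condLaw p μ n A) atTop (𝓝 ((ν.map some).toMeasure A))

/-- `E_x[exp (λ_cr (τ_Δ ∧ τ_x))]`. -/
noncomputable def stoppedMoment {S : Type*} (p : Option S → PMF (Option S)) (x : S) : ℝ≥0∞ :=
  ∫⁻ ω, expTime (critParam p) (min (absTime ω) (hitTime (some x) ω)) ∂(pointLaw p x)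

/-- `E_x[exp (λ_cr τ_Δ), τ_Δ < τ_x]`. -/
noncomputable def absFirstMoment {S : Type*} (p : Option S → PMF (Option S)) (x : S) : ℝ≥0∞ :=
  ∫⁻ ω in {ω | absTime ω < hitTime (some x) ω}, expTime (critParam p) (absTime ω)
    ∂(pointLaw p x)

/-- `E_x[exp (λ_cr τ_x) τ_x, τ_x < τ_Δ]`. -/
noncomputable def returnFirstMoment {S : Type*} (p : Option S → PMF (Option S)) (x : S) : ℝ≥0∞ :=
  ∫⁻ ω in {ω | hitTime (some x) ω < absTime ω},
    expTime (critParam p) (hitTime (some x) ω) * ((hitTime (some x) ω : ℕ∞) : ℝ≥0∞)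
    ∂(pointLaw p x)

end QSD

namespace QSD

variable {S : Type*}

/-! Write `R` for the exponential of `critParam p` and `Q` for `p` restricted to `S`. A minimal QSD
is exactly a probability vector with `R ν Q = ν` (`isMinimalQSD_iff`), so part 1 is a question about
`R`-invariant vectors of finite mass.

The candidate is the `R`-weighted Green vector `G` of the chain started at `x` and killed on its
return to `x`. It is invariant off `x`, and `R G Q` takes at `x` the value `F = E_x[R ^ τ_x, τ_x <
τ_Δ]`, while `G x = 1`. Below the critical parameter the full Green function is finite, which forces
`F ≤ 1` in the limit (`returnSum_critParam_le_one`). If `G` has finite mass and `F < 1`, the full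
Green vector is at most `G / (1 - F)`, against the infinite MGF regime; hence `F = 1`
(`returnSum_critParam_eq_one`) and `G` is invariant. Conversely `ν x • G ≤ ν` for every invariant
`ν`, with equality by irreducibility when `F = 1` (`smul_green_compl_eq`), so an invariant
probability makes the mass of `G` finite. Summation by parts turns that finiteness into `(∗)` and
the mass into `absFirstMoment` divided by `R - 1`.

For part 2, `h y = E_y[R ^ τ_x, τ_x < τ_Δ]` is harmonic for `K = R Q`, and the extra moment says
that `∑ ν h < ∞`. The orbit of `μ` under `K` stays in a compact interval `[0, c ν]`. There the
`h`-mass of the overlap with the multiple of `ν` having the same `h`-mass as `μ` is a Lyapunov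
function, and aperiodicity makes it grow strictly away from that multiple (`tendsto_iterate_push`).
Dominated convergence then gives the conditional laws, where the powers of `R` cancel. -/

instance instDiscreteMeasurableSpaceOption : DiscreteMeasurableSpace (Option S) :=
  ⟨fun _ => trivial⟩

instance instIsProbabilityMeasurePathLaw (p : Option S → PMF (Option S)) (μ : PMF (Option S)) :
    IsProbabilityMeasure (pathLaw p μ) := by
  unfold pathLaw
  infer_instance

instance instIsProbabilityMeasureInitLaw (p : Option S → PMF (Option S)) (μ : PMF S) :
    IsProbabilityMeasure (initLaw p μ) := by
  unfold initLaw
  infer_instance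

theorem pointLaw_eq_initLaw (p : Option S → PMF (Option S)) (x : S) :
    pointLaw p x = initLaw p (PMF.pure x) := by
  rw [pointLaw, initLaw, PMF.pure_map]

/-! ### Path law and one-step Markov property -/

/-- The Markov property for one step. -/
theorem pathLaw_inter_succ [Countable S] (p : Option S → PMF (Option S)) (μ : PMF (Option S))
    (n : ℕ) {H : Set (∀ _ : Finset.Iic n, Option S)} (hH : MeasurableSet H) (y : Option S) :
    pathLaw p μ (Preorder.frestrictLe n ⁻¹' H ∩ {ω | ω (n + 1) = y}) =
      ∑' a, pathLaw p μ (Preorder.frestrictLe n ⁻¹' H ∩ {ω | ω n = a}) * p a y := by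
  have hmeas : Measurable (Preorder.frestrictLe (π := fun _ => Option S) n) := by fun_prop
  have h1 : pathLaw p μ (Preorder.frestrictLe n ⁻¹' H ∩ {ω | ω (n + 1) = y}) =
      ((pathLaw p μ).map (fun ω => (Preorder.frestrictLe n ω, ω (n + 1)))) (H ×ˢ {y}) := by
    rw [Measure.map_apply (by fun_prop) (hH.prod (MeasurableSet.of_discrete))]
    rfl
  have h2 := Kernel.map_frestrictLe_trajMeasure_compProd_eq_map_trajMeasure
    (X := fun _ => Option S) (μ₀ := μ.toMeasure) (κ := historyKernel p) (a := n)
  rw [h1, pathLaw, ← h2, Measure.compProd_apply_prod hH MeasurableSet.of_discrete,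
    setLIntegral_map hH (Kernel.measurable_coe _ MeasurableSet.of_discrete) hmeas]
  have h3 : ∀ ω : ℕ → Option S,
      historyKernel p n (Preorder.frestrictLe n ω) {y} = p (ω n) y := fun ω => by
    have : historyKernel p n (Preorder.frestrictLe n ω) {y} = (p (ω n)).toMeasure {y} := rfl
    rw [this, PMF.toMeasure_apply_singleton _ _ MeasurableSet.of_discrete]
  simp_rw [h3]
  rw [← lintegral_map (f := fun a => p a y) (g := fun ω : ℕ → Option S => ω n)
    measurable_from_top (by fun_prop), lintegral_countable']
  refine tsum_congr fun a => ?_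
  rw [Measure.map_apply (by fun_prop) MeasurableSet.of_discrete, Measure.restrict_apply
    ((measurable_pi_apply n) MeasurableSet.of_discrete), mul_comm, Set.inter_comm]
  rfl

theorem pathLaw_zero (p : Option S → PMF (Option S)) (μ : PMF (Option S)) (y : Option S) :
    pathLaw p μ {ω | ω 0 = y} = μ y := by
  have h : (pathLaw p μ).map (fun ω => ω 0) = μ.toMeasure := by
    have h0 : (fun ω : ℕ → Option S => ω 0) =
        (fun h : (∀ _ : Finset.Iic 0, Option S) => h ⟨0, Finset.mem_Iic.2 le_rfl⟩) ∘
          Preorder.frestrictLe 0 := rfl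
    rw [h0, ← Measure.map_map (by fun_prop) (by fun_prop), pathLaw, Kernel.trajMeasure,
      Measure.map_comp _ _ (by fun_prop), Kernel.traj_map_frestrictLe,
      Kernel.partialTraj_self, Measure.id_comp, Measure.map_map (by fun_prop) (by fun_prop)]
    exact Measure.map_id
  rw [← PMF.toMeasure_apply_singleton μ y MeasurableSet.of_discrete, ← h,
    Measure.map_apply (by fun_prop) MeasurableSet.of_discrete]
  rfl

/-! ### Killed chains as iterated row vectors -/

/-- The row vector `v Q`. -/
noncomputable def push (Q : S → S → ℝ≥0∞) (v : S → ℝ≥0∞) : S → ℝ≥0∞ :=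
  fun z => ∑' y, v y * Q y z

/-- The transition function restricted to `S`, with target states restricted to `B`. -/
noncomputable def subKernel (p : Option S → PMF (Option S)) (B : Set S) : S → S → ℝ≥0∞ :=
  fun y => B.indicator fun z => p (some y) (some z)

/-- The event that the states at times `1, …, n` belong to `B ⊆ S`. -/
def stayEvent (B : Set S) (n : ℕ) : Set (ℕ → Option S) :=
  {ω | ∀ k, 1 ≤ k → k ≤ n → ω k ∈ some '' B}

theorem stayEvent_eq_preimage (B : Set S) (n : ℕ) :
    stayEvent B n = Preorder.frestrictLe (π := fun _ => Option S) n ⁻¹'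
      ⋂ k : Finset.Iic n, {h | 1 ≤ (k : ℕ) → h k ∈ some '' B} := by
  ext ω
  simp only [stayEvent, Set.mem_ofPred_eq, Set.mem_preimage, Set.mem_iInter, Subtype.forall,
    Finset.mem_Iic]
  exact ⟨fun h k hk h1 => h k h1 hk, fun h k h1 hk => h k hk h1⟩

theorem measurableSet_stayEvent_aux (B : Set S) (n : ℕ) :
    MeasurableSet (⋂ k : Finset.Iic n,
      {h : ∀ _ : Finset.Iic n, Option S | 1 ≤ (k : ℕ) → h k ∈ some '' B}) := by
  refine MeasurableSet.iInter fun k => ?_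
  by_cases hk : 1 ≤ (k : ℕ)
  · simp only [hk, forall_const]
    exact (measurable_pi_apply k) (MeasurableSet.of_discrete (s := some '' B))
  · simp [hk]

theorem measurableSet_stayEvent (B : Set S) (n : ℕ) : MeasurableSet (stayEvent B n) := by
  rw [stayEvent_eq_preimage]
  exact (by fun_prop : Measurable (Preorder.frestrictLe (π := fun _ => Option S) n))
    (measurableSet_stayEvent_aux B n)

theorem stayEvent_succ (B : Set S) (n : ℕ) :
    stayEvent B (n + 1) = stayEvent B n ∩ {ω | ω (n + 1) ∈ some '' B} := by
  ext ω
  constructor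
  · intro h
    exact ⟨fun k h1 hk => h k h1 (by omega), h (n + 1) (by omega) le_rfl⟩
  · rintro ⟨h, h'⟩ k h1 hk
    rcases Nat.lt_or_ge n k with hlt | hge
    · obtain rfl : k = n + 1 := by omega
      exact h'
    · exact h k h1 hge

theorem initLaw_zero (p : Option S → PMF (Option S)) (μ : PMF S) (z : S) :
    initLaw p μ {ω | ω 0 = some z} = μ z := by
  rw [initLaw, pathLaw_zero, PMF.map_apply, tsum_eq_single z]
  · simp
  · intro b hb
    simp [Ne.symm hb]

theorem initLaw_zero_none (p : Option S → PMF (Option S)) (μ : PMF S) :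
    initLaw p μ {ω | ω 0 = none} = 0 := by
  rw [initLaw, pathLaw_zero, PMF.map_apply]
  simp

theorem initLaw_stayEvent_inter_none (p : Option S → PMF (Option S)) (μ : PMF S) (B : Set S)
    (n : ℕ) : initLaw p μ (stayEvent B n ∩ {ω | ω n = none}) = 0 := by
  rcases n with _ | n
  · exact measure_mono_null Set.inter_subset_right (initLaw_zero_none p μ)
  · convert measure_empty (μ := initLaw p μ)
    ext ω
    simp only [Set.mem_inter_iff, Set.mem_ofPred_eq, Set.mem_empty_iff_false, iff_false, not_and]
    intro h h'
    have := h (n + 1) (by omega) le_rfl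
    simp [h'] at this

theorem tsum_option_eq {f : Option S → ℝ≥0∞} : ∑' a, f a = f none + ∑' z, f (some z) := by
  rw [← (Equiv.optionEquivSumPUnit.{0} S).symm.tsum_eq f,
    Summable.tsum_sum ENNReal.summable ENNReal.summable, add_comm]
  simp

/-- The law at time `n` is left as a hypothesis so that the same step serves inside the induction
for the killed chain and again, once that law is known, for the step back to the killing state. -/
theorem initLaw_stayEvent_inter_succ_of_eq [Countable S] (p : Option S → PMF (Option S))
    (μ : PMF S) (B : Set S) (n : ℕ) {v : S → ℝ≥0∞}
    (hv : ∀ z, initLaw p μ (stayEvent B n ∩ {ω | ω n = some z}) = v z) (z : S) :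
    initLaw p μ (stayEvent B n ∩ {ω | ω (n + 1) = some z}) =
      push (subKernel p Set.univ) v z := by
  have h := pathLaw_inter_succ p (μ.map some) n (measurableSet_stayEvent_aux B n) (some z)
  rw [← stayEvent_eq_preimage, tsum_option_eq] at h
  rw [initLaw, h]
  have h0 := initLaw_stayEvent_inter_none p μ B n
  rw [initLaw] at h0 hv
  simp [h0, hv, push, subKernel]

/-- The law of the chain killed at the first exit from `B` after time `0`. -/
theorem initLaw_stayEvent_inter [Countable S] (p : Option S → PMF (Option S)) (μ : PMF S)
    (B : Set S) (n : ℕ) (z : S) :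
    initLaw p μ (stayEvent B n ∩ {ω | ω n = some z}) = (push (subKernel p B))^[n] μ z := by
  induction n generalizing z with
  | zero =>
    rw [Function.iterate_zero, id, ← initLaw_zero p μ z]
    congr 1
    ext ω
    simp only [stayEvent, Set.mem_inter_iff, Set.mem_ofPred_eq, and_iff_right_iff_imp]
    intro _ k h1 h2
    omega
  | succ n ih =>
    rw [Function.iterate_succ_apply', stayEvent_succ]
    by_cases hz : z ∈ B
    · have : stayEvent B n ∩ {ω | ω (n + 1) ∈ some '' B} ∩ {ω | ω (n + 1) = some z} =
          stayEvent B n ∩ {ω | ω (n + 1) = some z} := by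
        ext ω
        simp only [Set.mem_inter_iff, Set.mem_ofPred_eq]
        refine ⟨fun h => ⟨h.1.1, h.2⟩, fun h => ⟨⟨h.1, ?_⟩, h.2⟩⟩
        rw [h.2]
        exact ⟨z, hz, rfl⟩
      rw [this, initLaw_stayEvent_inter_succ_of_eq p μ B n ih]
      simp [push, subKernel, hz]
    · have : stayEvent B n ∩ {ω | ω (n + 1) ∈ some '' B} ∩ {ω | ω (n + 1) = some z} = ∅ := by
        ext ω
        simp only [Set.mem_inter_iff, Set.mem_ofPred_eq, Set.mem_empty_iff_false, iff_false]
        rintro ⟨⟨_, y, hy, hy'⟩, h⟩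
        rw [h] at hy'
        exact hz (Option.some.inj hy' ▸ hy)
      rw [this, measure_empty]
      simp [push, subKernel, hz]

theorem initLaw_stayEvent_inter_succ [Countable S] (p : Option S → PMF (Option S)) (μ : PMF S)
    (B : Set S) (n : ℕ) (z : S) :
    initLaw p μ (stayEvent B n ∩ {ω | ω (n + 1) = some z}) =
      push (subKernel p Set.univ) ((push (subKernel p B))^[n] μ) z :=
  initLaw_stayEvent_inter_succ_of_eq p μ B n (initLaw_stayEvent_inter p μ B n) z

theorem initLaw_stayEvent_inter_mem [Countable S] (p : Option S → PMF (Option S)) (μ : PMF S)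
    (B : Set S) (n : ℕ) (A : Set (Option S)) :
    initLaw p μ (stayEvent B n ∩ {ω | ω n ∈ A}) =
      ∑' z, (some ⁻¹' A).indicator ((push (subKernel p B))^[n] μ) z := by
  have h1 : initLaw p μ (stayEvent B n ∩ {ω | ω n ∈ A}) =
      (((initLaw p μ).restrict (stayEvent B n)).map fun ω => ω n) A := by
    rw [Measure.map_apply (by fun_prop) MeasurableSet.of_discrete, Measure.restrict_apply
      ((measurable_pi_apply n) MeasurableSet.of_discrete), Set.inter_comm]
    rfl
  have h2 : ∀ a, (((initLaw p μ).restrict (stayEvent B n)).map fun ω => ω n) {a} =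
      initLaw p μ (stayEvent B n ∩ {ω | ω n = a}) := fun a => by
    rw [Measure.map_apply (by fun_prop) MeasurableSet.of_discrete, Measure.restrict_apply
      ((measurable_pi_apply n) MeasurableSet.of_discrete), Set.inter_comm]
    rfl
  rw [h1, ← lintegral_indicator_one MeasurableSet.of_discrete, lintegral_countable',
    tsum_option_eq]
  simp_rw [h2, initLaw_stayEvent_inter_none, initLaw_stayEvent_inter]
  rw [mul_zero, zero_add]
  refine tsum_congr fun z => ?_
  by_cases hz : some z ∈ A <;> simp [hz]

theorem initLaw_stayEvent [Countable S] (p : Option S → PMF (Option S)) (μ : PMF S)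
    (B : Set S) (n : ℕ) :
    initLaw p μ (stayEvent B n) = ∑' z, (push (subKernel p B))^[n] μ z := by
  have := initLaw_stayEvent_inter_mem p μ B n Set.univ
  simpa using this

/-! ### Hitting times and their exponential moments -/

theorem measurableSet_coord_mem (n : ℕ) (A : Set (Option S)) :
    MeasurableSet {ω : ℕ → Option S | ω n ∈ A} :=
  (measurable_pi_apply n) MeasurableSet.of_discrete

theorem coe_lt_hitTime_iff (y : Option S) (ω : ℕ → Option S) (n : ℕ) :
    (n : ℕ∞) < hitTime y ω ↔ ∀ k, 1 ≤ k → k ≤ n → ω k ≠ y := by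
  rw [← ENat.add_one_le_iff (ENat.natCast_ne_top n), hitTime]
  simp only [le_iInf_iff, and_imp]
  constructor
  · intro h k h1 hk hy
    have := h k h1 hy
    norm_cast at this
    omega
  · intro h k h1 hy
    by_contra hlt
    refine h k h1 ?_ hy
    norm_cast at hlt
    omega

theorem hitTime_pos (y : Option S) (ω : ℕ → Option S) : 0 < hitTime y ω := by
  have := (coe_lt_hitTime_iff y ω 0).2 (fun k h1 h2 => by omega)
  simpa using this

theorem hitTime_eq_succ_iff (y : Option S) (ω : ℕ → Option S) (n : ℕ) :
    hitTime y ω = (n + 1 : ℕ) ↔ (n : ℕ∞) < hitTime y ω ∧ ω (n + 1) = y := by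
  have h0 := coe_lt_hitTime_iff y ω n
  have h1 := coe_lt_hitTime_iff y ω (n + 1)
  constructor
  · intro h
    have h2 : (n : ℕ∞) < hitTime y ω := by rw [h]; exact_mod_cast Nat.lt_succ_self n
    refine ⟨h2, ?_⟩
    by_contra hne
    have : ((n + 1 : ℕ) : ℕ∞) < hitTime y ω := by
      rw [h1]
      intro k hk1 hk2
      rcases Nat.lt_or_ge n k with hlt | hge
      · obtain rfl : k = n + 1 := by omega
        exact hne
      · exact h0.1 h2 k hk1 hge
    exact this.ne' h
  · rintro ⟨h2, h3⟩
    refine le_antisymm (iInf₂_le (n + 1) ⟨by omega, h3⟩) ?_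
    have := Order.add_one_le_of_lt h2
    exact_mod_cast this

instance instBorelSpaceENat : BorelSpace ℕ∞ := by
  refine ⟨le_antisymm (fun s _ => ?_) le_top⟩
  let _ : MeasurableSpace ℕ∞ := borel ℕ∞
  have : BorelSpace ℕ∞ := ⟨rfl⟩
  exact (Set.to_countable s).measurableSet

theorem measurable_hitTime (y : Option S) : Measurable (hitTime y : (ℕ → Option S) → ℕ∞) := by
  refine measurable_of_Ioi fun a => ?_
  induction a using ENat.recTopCoe with
  | top => simp
  | coe n =>
    have : hitTime y ⁻¹' Set.Ioi (n : ℕ∞) =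
        ⋂ k : ℕ, ⋂ (_ : 1 ≤ k), ⋂ (_ : k ≤ n), {ω : ℕ → Option S | ω k ≠ y} := by
      ext ω
      simp [coe_lt_hitTime_iff]
    rw [this]
    exact MeasurableSet.iInter fun k => MeasurableSet.iInter fun _ => MeasurableSet.iInter fun _ =>
      measurableSet_coord_mem k {y}ᶜ

theorem measurable_absTime : Measurable (absTime : (ℕ → Option S) → ℕ∞) :=
  measurable_hitTime none

theorem measurable_expTime (l : ℝ) : Measurable (expTime l) :=
  measurable_of_countable _

theorem expTime_coe (l : ℝ) (n : ℕ) :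
    expTime l (n : ℕ∞) = ENNReal.ofReal (Real.exp l) ^ n := by
  rw [expTime, ← ENNReal.ofReal_pow (Real.exp_pos l).le, ← Real.exp_nat_mul]
  have : ((l : EReal) * (((n : ℕ∞) : ℝ≥0∞) : EReal)) = ((n * l : ℝ) : EReal) := by
    rw [mul_comm (n : ℝ) l]
    push_cast
    rfl
  rw [this, EReal.exp_coe]

theorem expTime_top {l : ℝ} (hl : 0 < l) : expTime l ⊤ = ∞ := by
  simp [expTime, EReal.coe_mul_top_of_pos hl]

theorem ofReal_exp_eq {l : ℝ} (hl : 0 < l) :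
    ENNReal.ofReal (Real.exp l) = 1 + ENNReal.ofReal (Real.exp l - 1) := by
  rw [← ENNReal.ofReal_one, ← ENNReal.ofReal_add zero_le_one (by simpa using hl.le)]
  congr 1
  ring

theorem one_add_pow_eq (d : ℝ≥0∞) (n : ℕ) :
    (1 + d) ^ n = 1 + d * ∑ k ∈ Finset.range n, (1 + d) ^ k := by
  induction n with
  | zero => simp
  | succ n ih =>
    rw [Finset.sum_range_succ, mul_add, ← add_assoc, ← ih]
    ring

/-- Geometric summation, which reduces moments to the tails of `t`. It survives at `t = ∞` because
`l > 0` makes the factor in front nonzero and the series diverge. -/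
theorem expTime_eq_tsum {l : ℝ} (hl : 0 < l) (t : ℕ∞) :
    expTime l t = 1 + ENNReal.ofReal (Real.exp l - 1) *
      ∑' n : ℕ, ENNReal.ofReal (Real.exp l) ^ n * {s : ℕ∞ | (n : ℕ∞) < s}.indicator 1 t := by
  have hd : ENNReal.ofReal (Real.exp l - 1) ≠ 0 := by simpa using hl
  induction t using ENat.recTopCoe with
  | top =>
    rw [expTime_top hl]
    have : ∑' n : ℕ, ENNReal.ofReal (Real.exp l) ^ n *
        {s : ℕ∞ | (n : ℕ∞) < s}.indicator 1 ⊤ = ∞ := by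
      refine top_unique ?_
      rw [← ENNReal.tsum_const_eq_top_of_ne_zero (α := ℕ) one_ne_zero]
      refine ENNReal.tsum_le_tsum fun n => ?_
      have : (1 : ℝ≥0∞) ≤ ENNReal.ofReal (Real.exp l) := by
        rw [ofReal_exp_eq hl]
        exact le_self_add
      simpa using one_le_pow₀ this
    rw [this, ENNReal.mul_top hd, add_top]
  | coe t =>
    rw [expTime_coe]
    have : ∑' n : ℕ, ENNReal.ofReal (Real.exp l) ^ n *
        {s : ℕ∞ | (n : ℕ∞) < s}.indicator 1 (t : ℕ∞) =
        ∑ n ∈ Finset.range t, ENNReal.ofReal (Real.exp l) ^ n := by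
      rw [tsum_eq_sum (s := Finset.range t)]
      · refine Finset.sum_congr rfl fun n hn => ?_
        rw [Finset.mem_range] at hn
        simp [hn]
      · intro n hn
        rw [Finset.mem_range, not_lt] at hn
        simp [hn]
    rw [this, ofReal_exp_eq hl]
    exact one_add_pow_eq _ _

theorem lintegral_expTime {Ω : Type*} [MeasurableSpace Ω] (P : Measure Ω)
    [IsProbabilityMeasure P] {l : ℝ} (hl : 0 < l) {T : Ω → ℕ∞} (hT : Measurable T) :
    ∫⁻ ω, expTime l (T ω) ∂P = 1 + ENNReal.ofReal (Real.exp l - 1) *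
      ∑' n : ℕ, ENNReal.ofReal (Real.exp l) ^ n * P {ω | (n : ℕ∞) < T ω} := by
  simp_rw [expTime_eq_tsum hl]
  have hm : ∀ n : ℕ, Measurable fun ω =>
      ({s : ℕ∞ | (n : ℕ∞) < s}.indicator (1 : ℕ∞ → ℝ≥0∞) (T ω)) := fun n =>
    
    (measurable_of_countable ({s : ℕ∞ | (n : ℕ∞) < s}.indicator (1 : ℕ∞ → ℝ≥0∞))).comp hT
  have hm' : ∀ n : ℕ, Measurable fun ω => ENNReal.ofReal (Real.exp l) ^ n *
      ({s : ℕ∞ | (n : ℕ∞) < s}.indicator (1 : ℕ∞ → ℝ≥0∞) (T ω)) := fun n => (hm n).const_mul _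
  rw [lintegral_add_left measurable_const, lintegral_const, measure_univ, mul_one,
    lintegral_const_mul _ (Measurable.tsum hm'),
    lintegral_tsum fun n => (hm' n).aemeasurable]
  congr 2
  refine tsum_congr fun n => ?_
  rw [lintegral_const_mul _ (hm n)]
  congr 1
  rw [← lintegral_indicator_one (s := {ω | (n : ℕ∞) < T ω})
    (hT (MeasurableSet.of_discrete (s := Set.Ioi (n : ℕ∞))))]
  rfl

/-! ### Moments as Green sums -/

/-- `∑ n, r ^ n * (v Q ^ n)`. -/
noncomputable def green (Q : S → S → ℝ≥0∞) (r : ℝ≥0∞) (v : S → ℝ≥0∞) : S → ℝ≥0∞ :=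
  fun z => ∑' n : ℕ, r ^ n * (push Q)^[n] v z

/-- `E_x[φ (τ_x), τ_x < τ_Δ]` in terms of the chain killed at its return to `x`. -/
noncomputable def returnSum (p : Option S → PMF (Option S)) (φ : ℕ → ℝ≥0∞) (x : S) : ℝ≥0∞ :=
  ∑' n : ℕ, φ (n + 1) *
    push (subKernel p Set.univ) ((push (subKernel p {x}ᶜ))^[n] (PMF.pure x)) x

theorem tsum_green (Q : S → S → ℝ≥0∞) (r : ℝ≥0∞) (v : S → ℝ≥0∞) :
    ∑' z, green Q r v z = ∑' n : ℕ, r ^ n * ∑' z, (push Q)^[n] v z := by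
  unfold green
  rw [ENNReal.tsum_comm]
  simp_rw [ENNReal.tsum_mul_left]

theorem coe_lt_absTime_eq (n : ℕ) :
    {ω : ℕ → Option S | (n : ℕ∞) < absTime ω} = stayEvent Set.univ n := by
  ext ω
  simp only [absTime, coe_lt_hitTime_iff, stayEvent, Set.mem_ofPred_eq, Set.image_univ,
    Set.mem_range]
  simp only [← Option.isSome_iff_exists, Option.ne_none_iff_isSome, eq_comm]

theorem coe_lt_min_eq (x : S) (n : ℕ) :
    {ω : ℕ → Option S | (n : ℕ∞) < min (absTime ω) (hitTime (some x) ω)} =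
      stayEvent {x}ᶜ n := by
  ext ω
  simp only [absTime, lt_min_iff, coe_lt_hitTime_iff, stayEvent, Set.mem_ofPred_eq]
  constructor
  · rintro ⟨h1, h2⟩ k hk hk'
    obtain ⟨z, hz⟩ := Option.ne_none_iff_exists'.1 (h1 k hk hk')
    refine ⟨z, fun hzx => h2 k hk hk' ?_, hz.symm⟩
    rw [hz, Set.mem_singleton_iff.1 hzx]
  · intro h
    refine ⟨fun k hk hk' => ?_, fun k hk hk' => ?_⟩ <;> obtain ⟨z, hz, hz'⟩ := h k hk hk'
    · simp [← hz']
    · rw [← hz']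
      simpa using hz

theorem initLaw_coe_lt_absTime [Countable S] (p : Option S → PMF (Option S)) (μ : PMF S) (n : ℕ) :
    initLaw p μ {ω | (n : ℕ∞) < absTime ω} = ∑' z, (push (subKernel p Set.univ))^[n] μ z := by
  rw [coe_lt_absTime_eq, initLaw_stayEvent]

theorem mgfAbs_eq [Countable S] (p : Option S → PMF (Option S)) {l : ℝ} (hl : 0 < l) (x : S) :
    mgfAbs p l x = 1 + ENNReal.ofReal (Real.exp l - 1) *
      ∑' z, green (subKernel p Set.univ) (ENNReal.ofReal (Real.exp l)) (PMF.pure x) z := by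
  rw [mgfAbs, pointLaw_eq_initLaw, lintegral_expTime _ hl measurable_absTime, tsum_green]
  simp_rw [initLaw_coe_lt_absTime]

theorem stoppedMoment_eq [Countable S] (p : Option S → PMF (Option S)) (hl : 0 < critParam p)
    (x : S) :
    stoppedMoment p x = 1 + ENNReal.ofReal (Real.exp (critParam p) - 1) *
      ∑' z, green (subKernel p {x}ᶜ) (ENNReal.ofReal (Real.exp (critParam p)))
        (PMF.pure x) z := by
  rw [stoppedMoment, pointLaw_eq_initLaw,
    lintegral_expTime _ hl (measurable_absTime.min (measurable_hitTime _)), tsum_green]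
  simp_rw [coe_lt_min_eq, initLaw_stayEvent]

/-- The `n`-th piece is the event `τ_x = n + 1 < τ_Δ`: `n` steps avoiding `x` and `Δ`, then one step
into `x`. -/
theorem return_eq_iUnion (x : S) :
    {ω : ℕ → Option S | hitTime (some x) ω < absTime ω} =
      ⋃ n : ℕ, stayEvent {x}ᶜ n ∩ {ω | ω (n + 1) = some x} := by
  ext ω
  simp only [Set.mem_ofPred_eq, Set.mem_iUnion, ← coe_lt_min_eq, Set.mem_inter_iff, lt_min_iff]
  constructor
  · intro h
    obtain ⟨m, hm⟩ := ENat.ne_top_iff_exists.1 (ne_top_of_lt h)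
    obtain ⟨n, rfl⟩ : ∃ n, m = n + 1 := Nat.exists_eq_succ_of_ne_zero fun h0 => by
      have := hitTime_pos (some x) ω
      rw [← hm, h0] at this
      simp at this
    obtain ⟨h1, h2⟩ := (hitTime_eq_succ_iff _ _ _).1 hm.symm
    exact ⟨n, ⟨h1.trans h, h1⟩, h2⟩
  · rintro ⟨n, ⟨h1, h2⟩, h3⟩
    rw [(hitTime_eq_succ_iff _ _ _).2 ⟨h2, h3⟩, absTime, coe_lt_hitTime_iff]
    intro k hk hk'
    rcases Nat.lt_or_ge n k with hlt | hge
    · obtain rfl : k = n + 1 := by omega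
      simp [h3]
    · exact (coe_lt_hitTime_iff _ _ _).1 h1 k hk hge

theorem hitTime_of_mem {x : S} {n : ℕ} {ω : ℕ → Option S}
    (h : ω ∈ stayEvent {x}ᶜ n ∩ {ω | ω (n + 1) = some x}) :
    hitTime (some x) ω = (n + 1 : ℕ) := by
  rw [← coe_lt_min_eq] at h
  exact (hitTime_eq_succ_iff _ _ _).2 ⟨(lt_min_iff.1 h.1).2, h.2⟩

theorem setLIntegral_return [Countable S] (p : Option S → PMF (Option S)) (x : S)
    (φ : ℕ∞ → ℝ≥0∞) :
    ∫⁻ ω in {ω | hitTime (some x) ω < absTime ω}, φ (hitTime (some x) ω) ∂(pointLaw p x) =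
      returnSum p (fun n => φ n) x := by
  have hm : ∀ n, MeasurableSet
      (stayEvent {x}ᶜ n ∩ {ω : ℕ → Option S | ω (n + 1) = some x}) := fun n =>
    (measurableSet_stayEvent _ n).inter
      (measurableSet_coord_mem (n + 1) {some x})
  rw [return_eq_iUnion, lintegral_iUnion hm, returnSum]
  · refine tsum_congr fun n => ?_
    rw [setLIntegral_congr_fun (hm n) (g := fun _ => φ (n + 1 : ℕ))
      fun ω h => by simp only [hitTime_of_mem h], setLIntegral_const, pointLaw_eq_initLaw,
      initLaw_stayEvent_inter_succ]
  · intro m n hmn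
    refine Set.disjoint_left.2 fun ω h1 h2 => hmn ?_
    have := (hitTime_of_mem h1).symm.trans (hitTime_of_mem h2)
    exact Nat.succ_injective (by exact_mod_cast this)

theorem returnFirstMoment_eq [Countable S] (p : Option S → PMF (Option S)) (x : S) :
    returnFirstMoment p x =
      returnSum p (fun n => ENNReal.ofReal (Real.exp (critParam p)) ^ n * n) x := by
  rw [returnFirstMoment, setLIntegral_return p x fun t => expTime (critParam p) t * (t : ℝ≥0∞)]
  simp [expTime_coe]

theorem stoppedMoment_eq_add [Countable S] (p : Option S → PMF (Option S))
    (hl : 0 < critParam p) (x : S) (h : stoppedMoment p x < ∞) :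
    stoppedMoment p x = absFirstMoment p x +
      returnSum p (fun n => ENNReal.ofReal (Real.exp (critParam p)) ^ n) x := by
  have hmin : Measurable fun ω : ℕ → Option S => min (absTime ω) (hitTime (some x) ω) :=
    measurable_absTime.min (measurable_hitTime _)
  have hset : MeasurableSet {ω : ℕ → Option S | absTime ω < hitTime (some x) ω} :=
    measurableSet_lt measurable_absTime (measurable_hitTime _)
  have hset' : MeasurableSet {ω : ℕ → Option S | hitTime (some x) ω < absTime ω} :=
    measurableSet_lt (measurable_hitTime _) measurable_absTime
  have hae := ae_lt_top ((measurable_expTime (critParam p)).comp hmin) h.ne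
  -- A tie `τ_Δ = τ_x` cannot be finite, since the chain would be in two states at once, and an
  -- infinite tie makes the integrand infinite, so it is null when the stopped moment is finite.
  have hcompl : ({ω : ℕ → Option S | absTime ω < hitTime (some x) ω}ᶜ : Set _)
      =ᵐ[pointLaw p x] {ω | hitTime (some x) ω < absTime ω} := by
    filter_upwards [hae] with ω hω
    refine propext ⟨fun h1 => ?_, fun h1 => not_lt.2 (le_of_lt h1)⟩
    have h1 : hitTime (some x) ω ≤ absTime ω := not_lt.1 h1
    refine lt_of_le_of_ne h1 fun h2 => ?_
    rw [Function.comp_apply, ← h2, min_self] at hω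
    have hfin : hitTime (some x) ω ≠ ⊤ := fun htop => by
      rw [htop, expTime_top hl] at hω
      exact lt_irrefl _ hω
    obtain ⟨m, hm⟩ := ENat.ne_top_iff_exists.1 hfin
    obtain ⟨n, rfl⟩ : ∃ n, m = n + 1 := Nat.exists_eq_succ_of_ne_zero fun h0 => by
      have := hitTime_pos (some x) ω
      rw [← hm, h0] at this
      simp at this
    have h3 := ((hitTime_eq_succ_iff _ _ _).1 hm.symm).2
    have h4 := ((hitTime_eq_succ_iff _ _ _).1 (h2.symm.trans hm.symm)).2
    rw [h3] at h4
    exact Option.some_ne_none _ h4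
  rw [stoppedMoment, ← lintegral_add_compl _ hset, setLIntegral_congr hcompl]
  congr 1
  · exact setLIntegral_congr_fun hset fun ω hω => by
      simp only [min_eq_left (le_of_lt (show absTime ω < hitTime (some x) ω from hω))]
  · rw [setLIntegral_congr_fun hset' (g := fun ω => expTime (critParam p) (hitTime (some x) ω))
      fun ω hω => by
        simp only [min_eq_right (le_of_lt (show hitTime (some x) ω < absTime ω from hω))],
      setLIntegral_return p x]
    simp_rw [expTime_coe]

/-! ### Algebra of row vectors and Green vectors -/

theorem push_mono (Q : S → S → ℝ≥0∞) : Monotone (push Q) := fun _ _ h _ =>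
  ENNReal.tsum_le_tsum fun y => mul_le_mul_left (h y) _

theorem push_add (Q : S → S → ℝ≥0∞) (v w : S → ℝ≥0∞) :
    push Q (v + w) = push Q v + push Q w := by
  ext z
  simp [push, add_mul, ENNReal.tsum_add]

theorem push_smul (Q : S → S → ℝ≥0∞) (c : ℝ≥0∞) (v : S → ℝ≥0∞) :
    push Q (c • v) = c • push Q v := by
  ext z
  simp [push, mul_assoc, ENNReal.tsum_mul_left]

theorem push_tsum {ι : Type*} (Q : S → S → ℝ≥0∞) (v : ι → S → ℝ≥0∞) :
    push Q (fun z => ∑' i, v i z) = fun z => ∑' i, push Q (v i) z := by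
  ext z
  simp only [push, ← ENNReal.tsum_mul_right]
  exact ENNReal.tsum_comm

theorem iterate_push_mono (Q : S → S → ℝ≥0∞) (n : ℕ) : Monotone (push Q)^[n] :=
  (push_mono Q).iterate n

theorem iterate_push_add (Q : S → S → ℝ≥0∞) (n : ℕ) (v w : S → ℝ≥0∞) :
    (push Q)^[n] (v + w) = (push Q)^[n] v + (push Q)^[n] w := by
  induction n with
  | zero => rfl
  | succ n ih => simp only [Function.iterate_succ_apply', ih, push_add]

theorem iterate_push_smul (Q : S → S → ℝ≥0∞) (n : ℕ) (c : ℝ≥0∞) (v : S → ℝ≥0∞) :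
    (push Q)^[n] (c • v) = c • (push Q)^[n] v := by
  induction n with
  | zero => rfl
  | succ n ih => simp only [Function.iterate_succ_apply', ih, push_smul]

theorem push_scaled (Q : S → S → ℝ≥0∞) (r : ℝ≥0∞) (v : S → ℝ≥0∞) :
    push (fun y z => r * Q y z) v = r • push Q v := by
  ext z
  simp only [push, Pi.smul_apply, smul_eq_mul, ← ENNReal.tsum_mul_left]
  exact tsum_congr fun y => by ring

theorem iterate_push_scaled (Q : S → S → ℝ≥0∞) (r : ℝ≥0∞) (n : ℕ) (v : S → ℝ≥0∞) :
    (push fun y z => r * Q y z)^[n] v = r ^ n • (push Q)^[n] v := by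
  induction n with
  | zero => simp
  | succ n ih =>
    rw [Function.iterate_succ_apply', ih, push_smul, push_scaled, Function.iterate_succ_apply',
      smul_smul, pow_succ]

theorem smul_pure_le (v : S → ℝ≥0∞) (x : S) : v x • ⇑(PMF.pure x) ≤ v := fun z => by
  by_cases h : z = x <;> simp [PMF.pure_apply, h]

/-- Keeping only the mass of `v` at `x` gives the lower bound through which irreducibility and
aperiodicity enter. -/
theorem smul_iterate_push_pure_le (Q : S → S → ℝ≥0∞) (n : ℕ) (v : S → ℝ≥0∞) (x : S) :
    v x • (push Q)^[n] (PMF.pure x) ≤ (push Q)^[n] v := by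
  rw [← iterate_push_smul]
  exact iterate_push_mono Q n (smul_pure_le v x)

theorem iterate_push_pos_add {Q : S → S → ℝ≥0∞} {m n : ℕ} {x y z : S}
    (h1 : 0 < (push Q)^[m] (PMF.pure x) y) (h2 : 0 < (push Q)^[n] (PMF.pure y) z) :
    0 < (push Q)^[m + n] (PMF.pure x) z := by
  rw [add_comm, Function.iterate_add_apply]
  exact (ENNReal.mul_pos h1.ne' h2.ne').trans_le
    (smul_iterate_push_pure_le Q n ((push Q)^[m] (PMF.pure x)) y z)

theorem green_eq_add (K : S → S → ℝ≥0∞) (r : ℝ≥0∞) (v : S → ℝ≥0∞) :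
    green K r v = v + r • push K (green K r v) := by
  have h : push K (green K r v) = fun z => ∑' n : ℕ, r ^ n * (push K)^[n + 1] v z := by
    unfold green
    rw [push_tsum K fun n z => r ^ n * (push K)^[n] v z]
    ext z
    refine tsum_congr fun n => ?_
    rw [Function.iterate_succ_apply']
    exact congrFun (push_smul K (r ^ n) ((push K)^[n] v)) z
  ext z
  rw [h]
  simp only [Pi.add_apply, Pi.smul_apply, smul_eq_mul, ← ENNReal.tsum_mul_left]
  rw [green, tsum_eq_zero_add']
  · simp only [pow_zero, one_mul, Function.iterate_zero, id, pow_succ]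
    congr 1
    exact tsum_congr fun n => by ring
  · exact ENNReal.summable

/-- `green K r v` is the smallest solution of `v + r w K = w`. -/
theorem green_le {K : S → S → ℝ≥0∞} {r : ℝ≥0∞} {v w : S → ℝ≥0∞}
    (h : v + r • push K w ≤ w) : green K r v ≤ w := by
  have key : ∀ N : ℕ, (∑ n ∈ Finset.range N, r ^ n • (push K)^[n] v) ≤ w := by
    intro N
    induction N with
    | zero => simp
    | succ N ih =>
      -- The partial sums are the iterates of `w ↦ v + r w K` from `0`, and any supersolution bounds
      -- all of them.
      have : ∀ M : ℕ, ∑ n ∈ Finset.range (M + 1), r ^ n • (push K)^[n] v =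
          v + r • push K (∑ n ∈ Finset.range M, r ^ n • (push K)^[n] v) := by
        intro M
        induction M with
        | zero => ext z; simp [push]
        | succ M ihM =>
          conv_rhs => rw [Finset.sum_range_succ, push_add, smul_add, push_smul,
            ← Function.iterate_succ_apply' (push K), smul_smul, ← pow_succ', ← add_assoc, ← ihM]
          rw [Finset.sum_range_succ]
      rw [this]
      exact le_trans (add_le_add_right (smul_le_smul_of_nonneg_left (push_mono K ih) zero_le) v) h
  intro z
  refine ENNReal.tsum_le_of_sum_range_le fun N => ?_
  simpa using key N z

theorem green_smul (K : S → S → ℝ≥0∞) (r c : ℝ≥0∞) (v : S → ℝ≥0∞) :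
    green K r (c • v) = c • green K r v := by
  ext z
  simp only [green, iterate_push_smul, Pi.smul_apply, smul_eq_mul, ← ENNReal.tsum_mul_left]
  exact tsum_congr fun n => by ring

theorem green_mono (K : S → S → ℝ≥0∞) (r : ℝ≥0∞) : Monotone (green K r) := fun _ _ h z =>
  ENNReal.tsum_le_tsum fun n => mul_le_mul_right (iterate_push_mono K n h z) _

theorem pow_smul_green_iterate_le (K : S → S → ℝ≥0∞) (r : ℝ≥0∞) (v : S → ℝ≥0∞) (n : ℕ) :
    r ^ n • green K r ((push K)^[n] v) ≤ green K r v := by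
  intro z
  simp only [green, Pi.smul_apply, smul_eq_mul, ← ENNReal.tsum_mul_left, ← mul_assoc, ← pow_add,
    ← Function.iterate_add_apply]
  have h := ENNReal.tsum_comp_le_tsum_of_injective (add_right_injective n)
    fun k => r ^ k * (push K)^[k] v z
  refine le_trans (le_of_eq (tsum_congr fun m => ?_)) h
  rw [add_comm m n]

/-! ### Dominated convergence and the convergence theorem -/

theorem tendsto_tsum_of_dominated [Countable S] {ι : Type*} {l : Filter ι}
    [l.IsCountablyGenerated] {F : ι → S → ℝ≥0∞} {f bound : S → ℝ≥0∞}
    (hb : ∀ i y, F i y ≤ bound y) (hfin : ∑' y, bound y ≠ ∞)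
    (hlim : ∀ y, Tendsto (fun i => F i y) l (𝓝 (f y))) :
    Tendsto (fun i => ∑' y, F i y) l (𝓝 (∑' y, f y)) := by
  let _ : MeasurableSpace S := ⊤
  have : DiscreteMeasurableSpace S := ⟨fun _ => trivial⟩
  simp_rw [← lintegral_count] at hfin ⊢
  exact tendsto_lintegral_filter_of_dominated_convergence bound
    (Eventually.of_forall fun _ => measurable_from_top)
    (Eventually.of_forall fun i => Eventually.of_forall (hb i)) hfin (Eventually.of_forall hlim)

theorem continuous_tsum_of_dominated [Countable S] {X : Type*} [TopologicalSpace X]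
    [FirstCountableTopology X] {F : X → S → ℝ≥0∞} {bound : S → ℝ≥0∞}
    (hb : ∀ x y, F x y ≤ bound y) (hfin : ∑' y, bound y ≠ ∞)
    (hc : ∀ y, Continuous fun x => F x y) : Continuous fun x => ∑' y, F x y :=
  continuous_iff_continuousAt.2 fun _ =>
    tendsto_tsum_of_dominated hb hfin fun y => (hc y).continuousAt

theorem eq_of_mapClusterPt {X Y ι : Type*} [TopologicalSpace X] [TopologicalSpace Y] [T2Space Y]
    {l : Filter ι} {g : X → Y} (hg : Continuous g) {u : ι → X} {v : X} {L : Y}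
    (hv : MapClusterPt v l u) (hL : Tendsto (fun i => g (u i)) l (𝓝 L)) : g v = L := by
  have h1 : MapClusterPt (g v) l (g ∘ u) := hv.continuousAt_comp hg.continuousAt
  have h2 : (𝓝 (g v) ⊓ 𝓝 L).NeBot := NeBot.mono h1 (inf_le_inf_left _ hL)
  exact eq_of_nhds_neBot h2

/-- LaSalle's invariance principle. -/
theorem tendsto_iterate_of_invariance {X Y : Type*} [TopologicalSpace X] [CompactSpace X]
    [TopologicalSpace Y] [T2Space Y] {T : X → X} (hT : Continuous T) {ψ : X → Y}
    (hψ : Continuous ψ) {x p : X} {L : Y} (hL : Tendsto (fun n => ψ (T^[n] x)) atTop (𝓝 L))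
    (huniq : ∀ v, MapClusterPt v atTop (fun n => T^[n] x) → (∀ j, ψ (T^[j] v) = L) → v = p) :
    Tendsto (fun n => T^[n] x) atTop (𝓝 p) := by
  refine tendsto_nhds_of_unique_mapClusterPt fun v hv => huniq v hv fun j => ?_
  -- Along the orbit, `ψ ∘ T^[j]` is a shift of a sequence that converges to `L`.
  refine eq_of_mapClusterPt (hψ.comp (hT.iterate j)) hv ?_
  refine (hL.comp (tendsto_add_atTop_nat j)).congr fun n => ?_
  simp only [Function.comp_apply, ← Function.iterate_add_apply, add_comm]

/-- By Tonelli, a harmonic `h` gives a conserved quantity, the `h`-mass of `v`. -/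
theorem tsum_push_mul {K : S → S → ℝ≥0∞} {h : S → ℝ≥0∞}
    (hh : ∀ y, ∑' z, K y z * h z = h y) (v : S → ℝ≥0∞) :
    ∑' z, push K v z * h z = ∑' y, v y * h y := by
  simp only [push, ← ENNReal.tsum_mul_right]
  rw [ENNReal.tsum_comm]
  refine tsum_congr fun y => ?_
  simp only [mul_assoc]
  rw [ENNReal.tsum_mul_left, hh]

theorem tsum_iterate_push_mul {K : S → S → ℝ≥0∞} {h : S → ℝ≥0∞}
    (hh : ∀ y, ∑' z, K y z * h z = h y) (n : ℕ) (v : S → ℝ≥0∞) :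
    ∑' z, (push K)^[n] v z * h z = ∑' y, v y * h y := by
  induction n with
  | zero => rfl
  | succ n ih => rw [Function.iterate_succ_apply', tsum_push_mul hh, ih]

/-- An ergodic theorem for a positive kernel with a positive invariant measure `ν` and a positive
harmonic function `h`, such that `∑ ν h < ∞`. -/
theorem tendsto_iterate_push [Countable S] {K : S → S → ℝ≥0∞} {ν h : S → ℝ≥0∞}
    (hν0 : ∀ z, ν z ≠ 0) (hνtop : ∀ z, ν z ≠ ∞) (h0 : ∀ y, h y ≠ 0) (htop : ∀ y, h y ≠ ∞)
    (hKν : push K ν = ν) (hKh : ∀ y, ∑' z, K y z * h z = h y) (hsum : ∑' z, ν z * h z ≠ ∞)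
    (hmeet : ∀ a b, ∃ (j : ℕ) (z : S),
      0 < (push K)^[j] (PMF.pure a) z ∧ 0 < (push K)^[j] (PMF.pure b) z)
    {u : S → ℝ≥0∞} {c : ℝ≥0∞} (hc : c ≠ ∞) (hu : u ≤ c • ν) (z : S) :
    Tendsto (fun n => (push K)^[n] u z) atTop
      (𝓝 ((∑' y, u y * h y) / (∑' y, ν y * h y) * ν z)) := by
  set D := ∑' y, u y * h y with hD
  set N := ∑' y, ν y * h y with hN
  -- `κ ν` is the multiple of `ν` with the same `h`-mass as `u`, the only possible limit.
  set κ := D / N with hκ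
  have hN0 : N ≠ 0 := fun h => by
    have := ENNReal.tsum_eq_zero.1 h z
    exact mul_ne_zero (hν0 z) (h0 z) this
  have hcN : ∑' y, c * ν y * h y = c * N := by
    simp_rw [mul_assoc]
    rw [ENNReal.tsum_mul_left]
  have hcNtop : ∑' y, c * ν y * h y ≠ ∞ := hcN ▸ ENNReal.mul_ne_top hc hsum
  have hDle : D ≤ c * N := hcN ▸ ENNReal.tsum_le_tsum fun y => mul_le_mul_left (hu y) _
  have hκc : κ ≤ c := ENNReal.div_le_of_le_mul hDle
  have hDtop : D ≠ ∞ := ne_top_of_le_ne_top (ENNReal.mul_ne_top hc hsum) hDle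
  have hκD : ∑' y, (κ • ν) y * h y = D := by
    simp_rw [Pi.smul_apply, smul_eq_mul, mul_assoc]
    rw [ENNReal.tsum_mul_left, hκ, ENNReal.div_mul_cancel hN0 hsum]
  -- Multiplication by a constant is continuous on `ℝ≥0∞` only if the constant is finite; continuity
  -- of `T` needs this.
  have hKfin : ∀ y z, K y z ≠ ∞ := fun y z hyz => by
    have h1 : ν y * K y z ≤ ν z := by
      conv_rhs => rw [← hKν]
      exact ENNReal.le_tsum (f := fun y => ν y * K y z) y
    rw [hyz, ENNReal.mul_top (hν0 y)] at h1
    exact hνtop z (top_unique h1)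
  let X := {v : S → ℝ≥0∞ // v ≤ c • ν}
  have hXc : CompactSpace X := isCompact_iff_compactSpace.1 (isClosed_Iic (a := c • ν)).isCompact
  have hXf : SecondCountableTopology X :=
    Topology.IsInducing.subtypeVal.secondCountableTopology
  let T : X → X := fun v => ⟨push K v.1, (push_mono K v.2).trans (by rw [push_smul, hKν])⟩
  have hTiter : ∀ (n : ℕ) (v : X), (T^[n] v).1 = (push K)^[n] v.1 := fun n v => by
    induction n with
    | zero => rfl
    | succ n ih => rw [Function.iterate_succ_apply', Function.iterate_succ_apply', ← ih]
  have hcoord : ∀ y, Continuous fun v : X => v.1 y := fun y =>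
    (continuous_apply y).comp continuous_subtype_val
  have hT : Continuous T := by
    refine Continuous.subtype_mk (continuous_pi fun z => ?_) _
    refine continuous_tsum_of_dominated (bound := fun y => c * ν y * K y z)
      (fun v y => mul_le_mul_left (v.2 y) _) ?_ fun y =>
      (ENNReal.continuous_mul_const (hKfin y z)).comp (hcoord y)
    have : ∑' y, c * ν y * K y z = c * ν z := by
      simp_rw [mul_assoc]
      rw [ENNReal.tsum_mul_left]
      exact congrArg (c * ·) (congrFun hKν z)
    rw [this]
    exact ENNReal.mul_ne_top hc (hνtop z)
  let s : X → ℝ≥0∞ := fun v => ∑' y, v.1 y * h y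
  have hs : Continuous s := continuous_tsum_of_dominated (bound := fun y => c * ν y * h y)
    (fun v y => mul_le_mul_left (v.2 y) _) hcNtop fun y =>
      (ENNReal.continuous_mul_const (htop y)).comp (hcoord y)
  -- The Lyapunov function: the `h`-mass shared with `κ ν`. It cannot decrease, as the common part
  -- is pushed below both vectors.
  let ψ : X → ℝ≥0∞ := fun v => ∑' y, (v.1 ⊓ κ • ν) y * h y
  have hψ : Continuous ψ := continuous_tsum_of_dominated (bound := fun y => c * ν y * h y)
    (fun v y => mul_le_mul_left (inf_le_left.trans (v.2 y)) _) hcNtop fun y =>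
      (ENNReal.continuous_mul_const (htop y)).comp ((hcoord y).min continuous_const)
  have hκinv : ∀ n, (push K)^[n] (κ • ν) = κ • ν := fun n =>
    Function.iterate_fixed (by rw [push_smul, hKν]) n
  have hψT : ∀ v, ψ v ≤ ψ (T v) := fun v => by
    change ∑' y, (v.1 ⊓ κ • ν) y * h y ≤ _
    rw [← tsum_push_mul hKh]
    refine ENNReal.tsum_le_tsum fun y => mul_le_mul_left ?_ _
    refine le_inf (push_mono K inf_le_left y) ?_
    refine (push_mono K inf_le_right y).trans ?_
    rw [push_smul, hKν]
  have hmono : ∀ x : X, Monotone fun n => ψ (T^[n] x) := fun x =>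
    monotone_nat_of_le_succ fun n => by
      rw [Function.iterate_succ_apply']
      exact hψT _
  let x : X := ⟨u, hu⟩
  let p : X := ⟨κ • ν, fun y => mul_le_mul_left hκc _⟩
  have hlim : Tendsto (fun n => T^[n] x) atTop (𝓝 p) := by
    refine tendsto_iterate_of_invariance hT hψ (tendsto_atTop_iSup (hmono x)) fun v hv hvL => ?_
    have hsv : s v = D := by
      refine eq_of_mapClusterPt hs hv ?_
      have : ∀ n, s (T^[n] x) = D := fun n => by
        change ∑' y, (T^[n] x).1 y * h y = D
        rw [hTiter, tsum_iterate_push_mul hKh]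
      simp only [this, tendsto_const_nhds]
    have hne : ∀ v w : S → ℝ≥0∞, ∑' y, v y * h y = D → ∑' y, w y * h y = D → v ≤ w → v = w := by
      intro v w hv hw hvw
      by_contra hne
      obtain ⟨y, hy⟩ : ∃ y, v y ≠ w y := Function.ne_iff.1 hne
      have := ENNReal.tsum_lt_tsum (hv ▸ hDtop) (fun y => mul_le_mul_left (hvw y) (h y))
        (ENNReal.mul_lt_mul_left (h0 y) (htop y) (lt_of_le_of_ne (hvw y) hy))
      rw [hv, hw] at this
      exact lt_irrefl _ this
    by_contra hvp
    have hvp' : v.1 ≠ κ • ν := fun h => hvp (Subtype.ext h)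
    -- Two different vectors of the same finite `h`-mass are incomparable, so each exceeds the other
    -- somewhere.
    obtain ⟨a, ha⟩ : ∃ a, (κ • ν) a < v.1 a := by
      by_contra! hle
      exact hvp' (hne _ _ hsv hκD hle)
    obtain ⟨b, hb⟩ : ∃ b, v.1 b < (κ • ν) b := by
      by_contra! hle
      exact hvp' (hne _ _ hκD hsv hle).symm
    set m := v.1 ⊓ κ • ν with hm
    have hva : v.1 = m + (v.1 - m) := (add_tsub_cancel_of_le inf_le_left).symm
    have hpb : κ • ν = m + (κ • ν - m) := (add_tsub_cancel_of_le inf_le_right).symm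
    have ha' : 0 < (v.1 - m) a := tsub_pos_of_lt (inf_le_right.trans_lt ha)
    have hb' : 0 < (κ • ν - m) b := tsub_pos_of_lt (inf_le_left.trans_lt hb)
    obtain ⟨j, y, hja, hjb⟩ := hmeet a b
    have hja' : 0 < (push K)^[j] (v.1 - m) y :=
      (ENNReal.mul_pos ha'.ne' hja.ne').trans_le (smul_iterate_push_pure_le K j (v.1 - m) a y)
    have hjb' : 0 < (push K)^[j] (κ • ν - m) y :=
      (ENNReal.mul_pos hb'.ne' hjb.ne').trans_le (smul_iterate_push_pure_le K j (κ • ν - m) b y)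
    have hj := hvL j
    have h00 := hvL 0
    rw [← hj] at h00
    refine h00.not_lt ?_
    have hψv : ψ (T^[0] v) = ∑' y, (push K)^[j] m y * h y :=
      (tsum_iterate_push_mul hKh j m).symm
    have hfin : ∑' y, (push K)^[j] m y * h y ≠ ∞ := by
      rw [tsum_iterate_push_mul hKh]
      refine ne_top_of_le_ne_top hDtop (hκD ▸ ENNReal.tsum_le_tsum fun y => ?_)
      exact mul_le_mul_left (inf_le_right) _
    -- After `j` steps the overlap contains the pushed old overlap and also the overlap of the two
    -- pushed excesses, which is positive where they meet. So `ψ` increases strictly, although it is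
    -- constant along the orbit of a cluster point.
    have hmin : ∀ y, (push K)^[j] m y +
        min ((push K)^[j] (v.1 - m) y) ((push K)^[j] (κ • ν - m) y) ≤
        ((T^[j] v).1 ⊓ κ • ν) y := fun y => by
      refine le_inf ?_ ?_
      · rw [hTiter]
        conv_rhs => rw [hva, iterate_push_add]
        exact add_le_add_right (min_le_left _ _) _
      · conv_rhs => rw [← hκinv j, hpb, iterate_push_add]
        exact add_le_add_right (min_le_right _ _) _
    rw [hψv]
    refine ENNReal.tsum_lt_tsum (i := y) hfin
      (fun y => mul_le_mul_left (le_self_add.trans (hmin y)) _) ?_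
    refine ENNReal.mul_lt_mul_left (h0 y) (htop y) (lt_of_lt_of_le ?_ (hmin y))
    refine ENNReal.lt_add_right (fun hy => hfin ?_) (lt_min hja' hjb').ne'
    exact ENNReal.tsum_eq_top_of_eq_top ⟨y, by rw [hy, ENNReal.top_mul (h0 y)]⟩
  have := ((hcoord z).tendsto p).comp hlim
  refine this.congr fun n => ?_
  simp [hTiter, x]

/-! ### The chain killed at its return to a state -/

theorem push_subKernel_of_mem (p : Option S → PMF (Option S)) {B : Set S} (v : S → ℝ≥0∞) {z : S}
    (hz : z ∈ B) : push (subKernel p B) v z = push (subKernel p Set.univ) v z := by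
  simp [push, subKernel, hz]

theorem push_subKernel_of_notMem (p : Option S → PMF (Option S)) {B : Set S} (v : S → ℝ≥0∞)
    {z : S} (hz : z ∉ B) : push (subKernel p B) v z = 0 := by
  simp [push, subKernel, hz]

theorem green_compl_self (p : Option S → PMF (Option S)) (r : ℝ≥0∞) (x : S) :
    green (subKernel p {x}ᶜ) r (PMF.pure x) x = 1 := by
  rw [green_eq_add]
  simp [push_subKernel_of_notMem]

theorem mul_push_green_compl_of_ne (p : Option S → PMF (Option S)) (r : ℝ≥0∞) {x z : S}
    (hz : z ≠ x) :
    r * push (subKernel p Set.univ) (green (subKernel p {x}ᶜ) r (PMF.pure x)) z =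
      green (subKernel p {x}ᶜ) r (PMF.pure x) z := by
  conv_rhs => rw [green_eq_add]
  simp [PMF.pure_apply, hz, push_subKernel_of_mem p _ (show z ∈ ({x}ᶜ : Set S) from hz)]

/-- Decomposition at the first return: one unrestricted step into `x` closes an excursion of the
killed chain. -/
theorem mul_push_green_compl_self (p : Option S → PMF (Option S)) (r : ℝ≥0∞) (x : S) :
    r * push (subKernel p Set.univ) (green (subKernel p {x}ᶜ) r (PMF.pure x)) x =
      returnSum p (fun n => r ^ n) x := by
  unfold green
  rw [push_tsum _ fun n z => r ^ n * (push (subKernel p {x}ᶜ))^[n] (PMF.pure x) z, returnSum,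
    ← ENNReal.tsum_mul_left]
  refine tsum_congr fun n => ?_
  rw [show (fun z => r ^ n * (push (subKernel p {x}ᶜ))^[n] (PMF.pure x) z) =
    r ^ n • (push (subKernel p {x}ᶜ))^[n] (PMF.pure x) from rfl, push_smul, pow_succ',
    Pi.smul_apply, smul_eq_mul, mul_assoc]

/-- At `x` the killed kernel contributes nothing and the source is `v x`; off `x` it agrees with the
full one. So `v` is a supersolution of the equation whose least solution is the left side. -/
theorem smul_green_compl_le (p : Option S → PMF (Option S)) {r : ℝ≥0∞} {x : S} {v : S → ℝ≥0∞}
    (hv : ∀ z, r * push (subKernel p Set.univ) v z ≤ v z) :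
    v x • green (subKernel p {x}ᶜ) r (PMF.pure x) ≤ v := by
  rw [← green_smul]
  refine green_le fun z => ?_
  by_cases hz : z = x
  · subst hz
    simp [push_subKernel_of_notMem]
  · simpa [PMF.pure_apply, hz, push_subKernel_of_mem p _ (show z ∈ ({x}ᶜ : Set S) from hz)]
      using hv z

/-- The full Green vector `U` is a supersolution, so it dominates `U x` times the killed one. One
more step into `x` gives `U x * F ≤ U x`, and `U x` is nonzero and finite. -/
theorem returnSum_le_one_of_green_ne_top (p : Option S → PMF (Option S)) {r : ℝ≥0∞} {x : S}
    (h : green (subKernel p Set.univ) r (PMF.pure x) x ≠ ∞) :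
    returnSum p (fun n => r ^ n) x ≤ 1 := by
  set U := green (subKernel p Set.univ) r (PMF.pure x) with hU
  have hUeq : U = ⇑(PMF.pure x) + r • push (subKernel p Set.univ) U := green_eq_add _ _ _
  have hsup : ∀ z, r * push (subKernel p Set.univ) U z ≤ U z := fun z => by
    conv_rhs => rw [hUeq]
    exact le_add_self
  have h1 : U x ≠ 0 := by
    rw [hUeq]
    simp
  have h2 : U x * returnSum p (fun n => r ^ n) x ≤ U x * 1 := by
    rw [mul_one, ← mul_push_green_compl_self]
    calc U x * (r * push (subKernel p Set.univ) (green (subKernel p {x}ᶜ) r (PMF.pure x)) x)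
        = r * push (subKernel p Set.univ)
            (U x • green (subKernel p {x}ᶜ) r (PMF.pure x)) x := by
          rw [push_smul, Pi.smul_apply, smul_eq_mul]
          ring
      _ ≤ r * push (subKernel p Set.univ) U x :=
          mul_le_mul_right (push_mono _ (smul_green_compl_le p hsup) x) _
      _ ≤ U x := hsup x
  exact (ENNReal.mul_le_mul_iff_right h1 h).1 h2

/-- Renewal: successive excursions carry weights `F ^ k`, which suggests the supersolution `(1 -
F)⁻¹ • G`. -/
theorem tsum_green_ne_top_of_returnSum_lt_one (p : Option S → PMF (Option S)) {r : ℝ≥0∞} {x : S}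
    (hF : returnSum p (fun n => r ^ n) x < 1)
    (hM : ∑' z, green (subKernel p {x}ᶜ) r (PMF.pure x) z ≠ ∞) :
    ∑' z, green (subKernel p Set.univ) r (PMF.pure x) z ≠ ∞ := by
  set F := returnSum p (fun n => r ^ n) x with hFdef
  set G := green (subKernel p {x}ᶜ) r (PMF.pure x) with hG
  have h0 : 1 - F ≠ 0 := (tsub_pos_of_lt hF).ne'
  have htop : 1 - F ≠ ∞ := ne_top_of_le_ne_top ENNReal.one_ne_top tsub_le_self
  have hle : green (subKernel p Set.univ) r (PMF.pure x) ≤ (1 - F)⁻¹ • G := by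
    refine green_le fun z => ?_
    rw [push_smul]
    simp only [Pi.add_apply, Pi.smul_apply, smul_eq_mul]
    rw [mul_left_comm]
    by_cases hz : z = x
    · subst hz
      rw [mul_push_green_compl_self, hG, green_compl_self, PMF.pure_apply_self, ← hFdef, mul_one]
      calc 1 + (1 - F)⁻¹ * F = (1 - F)⁻¹ * (1 - F) + (1 - F)⁻¹ * F := by
            rw [ENNReal.inv_mul_cancel h0 htop]
        _ = (1 - F)⁻¹ := by rw [← mul_add, tsub_add_cancel_of_le hF.le, mul_one]
        _ ≤ _ := le_rfl
    · rw [mul_push_green_compl_of_ne p r hz]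
      simp [PMF.pure_apply, hz, hG]
  refine ne_top_of_le_ne_top ?_ (ENNReal.tsum_le_tsum hle)
  simp only [Pi.smul_apply, smul_eq_mul]
  rw [ENNReal.tsum_mul_left]
  exact ENNReal.mul_ne_top (ENNReal.inv_ne_top.2 h0) hM

/-! ### Consequences of irreducibility -/

theorem initLaw_coord [Countable S] (p : Option S → PMF (Option S))
    (habs : p none = PMF.pure none) (μ : PMF S) (n : ℕ) (z : S) :
    initLaw p μ {ω | ω n = some z} = (push (subKernel p Set.univ))^[n] μ z := by
  induction n generalizing z with
  | zero => exact initLaw_zero p μ z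
  | succ n ih =>
    have h := pathLaw_inter_succ p (μ.map some) n MeasurableSet.univ (some z)
    simp only [Set.preimage_univ, Set.univ_inter] at h
    rw [initLaw, h, tsum_option_eq, Function.iterate_succ_apply']
    rw [initLaw] at ih
    simp [habs, ih, push, subKernel]

theorem IsIrreducible.exists_iterate_push_pos [Countable S] {p : Option S → PMF (Option S)}
    (habs : p none = PMF.pure none) (hirr : IsIrreducible p) (x y : S) :
    ∃ n, 0 < (push (subKernel p Set.univ))^[n] (PMF.pure x) y := by
  obtain ⟨n, -, hn⟩ := hirr x y
  rw [pointLaw_eq_initLaw, initLaw_coord p habs] at hn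
  exact ⟨n, hn⟩

/-- The Green vector from `x` contains a positive multiple of the one from `y`, so finiteness passes
from `x` to every state it reaches. -/
theorem tsum_green_ne_top_of_iterate_pos {K : S → S → ℝ≥0∞} {r : ℝ≥0∞} (hr : r ≠ 0)
    {n : ℕ} {x y : S} (hn : 0 < (push K)^[n] (PMF.pure x) y)
    (hx : ∑' z, green K r (PMF.pure x) z ≠ ∞) : ∑' z, green K r (PMF.pure y) z ≠ ∞ := by
  set c := r ^ n * (push K)^[n] (PMF.pure x) y with hc
  have hc0 : c ≠ 0 := mul_ne_zero (pow_ne_zero n hr) hn.ne'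
  have hle : c • green K r (PMF.pure y) ≤ green K r (PMF.pure x) := by
    refine le_trans ?_ (pow_smul_green_iterate_le K r (PMF.pure x) n)
    rw [hc, mul_smul, ← green_smul K r ((push K)^[n] (PMF.pure x) y)]
    exact smul_le_smul_of_nonneg_left (green_mono K r (smul_pure_le _ y)) zero_le
  have h := ENNReal.tsum_le_tsum hle
  simp only [Pi.smul_apply, smul_eq_mul] at h
  rw [ENNReal.tsum_mul_left] at h
  intro htop
  rw [htop, ENNReal.mul_top hc0] at h
  exact hx (top_unique h)

/-- At parameter `0` the moment is `1`, so an infinite moment excludes the value `0`, including the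
default value of `sSup`. -/
theorem critParam_pos (p : Option S → PMF (Option S)) (hinf : InfiniteMGF p) :
    0 < critParam p := by
  refine lt_of_le_of_ne (Real.sSup_nonneg fun l hl => hl.1.le) fun h0 => ?_
  obtain ⟨x, hx⟩ := hinf
  rw [mgfAbs, ← h0, pointLaw_eq_initLaw] at hx
  simp [expTime] at hx

theorem mgfAbs_ne_top_iff [Countable S] (p : Option S → PMF (Option S)) {l : ℝ} (hl : 0 < l)
    (x : S) : mgfAbs p l x ≠ ∞ ↔
      ∑' z, green (subKernel p Set.univ) (ENNReal.ofReal (Real.exp l)) (PMF.pure x) z ≠ ∞ := by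
  have hd : ENNReal.ofReal (Real.exp l - 1) ≠ 0 := by simpa using hl
  rw [mgfAbs_eq p hl]
  constructor
  · intro h h'
    rw [h', ENNReal.mul_top hd, add_top] at h
    exact h rfl
  · exact fun h => ENNReal.add_ne_top.2
      ⟨ENNReal.one_ne_top, ENNReal.mul_ne_top ENNReal.ofReal_ne_top h⟩

theorem green_mono_left (K : S → S → ℝ≥0∞) {r s : ℝ≥0∞} (h : r ≤ s) (v : S → ℝ≥0∞) :
    green K r v ≤ green K s v := fun _ =>
  ENNReal.tsum_le_tsum fun n => mul_le_mul_left (pow_le_pow_left₀ zero_le h n) _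

theorem tsum_green_ne_top_of_lt_critParam [Countable S] {p : Option S → PMF (Option S)}
    (habs : p none = PMF.pure none) (hirr : IsIrreducible p) (hmom : HasExpMoment p) {l : ℝ}
    (hl : l < critParam p) (x : S) :
    ∑' z, green (subKernel p Set.univ) (ENNReal.ofReal (Real.exp l)) (PMF.pure x) z ≠ ∞ := by
  obtain ⟨β, hβ, y, hy⟩ := hmom
  obtain ⟨l', ⟨hl'0, w, hw⟩, hll'⟩ := exists_lt_of_lt_csSup
    (s := {l : ℝ | 0 < l ∧ ∃ x : S, mgfAbs p l x < ∞}) ⟨β, hβ, y, hy⟩ hl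
  have h1 := (mgfAbs_ne_top_iff p hl'0 w).1 hw.ne
  obtain ⟨n, hn⟩ := hirr.exists_iterate_push_pos habs w x
  have h2 := tsum_green_ne_top_of_iterate_pos
    (ENNReal.ofReal_pos.2 (Real.exp_pos l')).ne' hn h1
  refine ne_top_of_le_ne_top h2 (ENNReal.tsum_le_tsum ?_)
  exact green_mono_left _ (ENNReal.ofReal_le_ofReal (Real.exp_le_exp.2 hll'.le)) _

theorem tsum_green_critParam_eq_top [Countable S] {p : Option S → PMF (Option S)}
    (habs : p none = PMF.pure none) (hirr : IsIrreducible p) (hinf : InfiniteMGF p) (x : S) :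
    ∑' z, green (subKernel p Set.univ) (ENNReal.ofReal (Real.exp (critParam p)))
      (PMF.pure x) z = ∞ := by
  have hpos := critParam_pos p hinf
  obtain ⟨y, hy⟩ := hinf
  by_contra h
  obtain ⟨n, hn⟩ := hirr.exists_iterate_push_pos habs x y
  exact (mgfAbs_ne_top_iff p hpos y).2 (tsum_green_ne_top_of_iterate_pos
    (ENNReal.ofReal_pos.2 (Real.exp_pos _)).ne' hn h) hy

theorem returnSum_critParam_le_one [Countable S] {p : Option S → PMF (Option S)}
    (habs : p none = PMF.pure none) (hirr : IsIrreducible p) (hmom : HasExpMoment p) (x : S) :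
    returnSum p (fun n => ENNReal.ofReal (Real.exp (critParam p)) ^ n) x ≤ 1 := by
  refine ENNReal.tsum_le_of_sum_range_le fun N => ?_
  set f : ℕ → ℝ≥0∞ := fun n =>
    push (subKernel p Set.univ) ((push (subKernel p {x}ᶜ))^[n] (PMF.pure x)) x with hf
  have hfin : ∀ n, f n ≠ ∞ := fun n => by
    simp only [hf]
    rw [← initLaw_stayEvent_inter_succ]
    exact measure_ne_top _ _
  have hcont : Continuous fun l : ℝ =>
      ∑ n ∈ Finset.range N, ENNReal.ofReal (Real.exp l) ^ (n + 1) * f n :=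
    continuous_finsetSum _ fun n _ => (ENNReal.continuous_mul_const (hfin n)).comp
      ((ENNReal.continuous_pow _).comp (ENNReal.continuous_ofReal.comp Real.continuous_exp))
  -- Only finite partial sums are known to be continuous in the parameter, so the bound is taken to
  -- the left limit for each of them.
  refine le_of_tendsto ((hcont.tendsto (critParam p)).mono_left
    (nhdsWithin_le_nhds (s := Set.Iio (critParam p)))) ?_
  filter_upwards [self_mem_nhdsWithin] with l hl
  refine le_trans (ENNReal.sum_le_tsum _) (returnSum_le_one_of_green_ne_top p ?_)
  exact ENNReal.ne_top_of_tsum_ne_top (tsum_green_ne_top_of_lt_critParam habs hirr hmom hl x) x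

theorem returnSum_critParam_eq_one [Countable S] {p : Option S → PMF (Option S)}
    (habs : p none = PMF.pure none) (hirr : IsIrreducible p) (hmom : HasExpMoment p)
    (hinf : InfiniteMGF p) {x : S}
    (hM : ∑' z, green (subKernel p {x}ᶜ) (ENNReal.ofReal (Real.exp (critParam p)))
      (PMF.pure x) z ≠ ∞) :
    returnSum p (fun n => ENNReal.ofReal (Real.exp (critParam p)) ^ n) x = 1 := by
  refine le_antisymm (returnSum_critParam_le_one habs hirr hmom x) (not_lt.1 fun hlt => ?_)
  exact tsum_green_ne_top_of_returnSum_lt_one p hlt hM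
    (tsum_green_critParam_eq_top habs hirr hinf x)

/-! ### Minimal quasistationary distributions as invariant vectors -/

theorem condLaw_apply [Countable S] (p : Option S → PMF (Option S)) (μ : PMF S) (n : ℕ)
    (A : Set (Option S)) :
    condLaw p μ n A = (∑' z, (push (subKernel p Set.univ))^[n] μ z)⁻¹ *
      ∑' z, (some ⁻¹' A).indicator ((push (subKernel p Set.univ))^[n] μ) z := by
  rw [condLaw, Measure.map_apply (by fun_prop) MeasurableSet.of_discrete, coe_lt_absTime_eq,
    cond_apply (measurableSet_stayEvent _ n), initLaw_stayEvent, ← initLaw_stayEvent_inter_mem]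
  rfl

theorem toMeasure_map_some_apply (ν : PMF S) (A : Set (Option S)) :
    (ν.map some).toMeasure A = ∑' z, (some ⁻¹' A).indicator ν z := by
  rw [PMF.toMeasure_apply _ MeasurableSet.of_discrete, tsum_option_eq]
  have h0 : (ν.map some) none = 0 := by simp [PMF.map_apply]
  have h1 : ∀ z, (ν.map some) (some z) = ν z := fun z => by
    rw [PMF.map_apply, tsum_eq_single z]
    · simp
    · intro b hb
      simp [Ne.symm hb]
  have h2 : A.indicator (ν.map some) none = 0 := by
    by_cases h : none ∈ A <;> simp [h, h0]
  rw [h2, zero_add]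
  refine tsum_congr fun z => ?_
  by_cases h : some z ∈ A <;> simp [h, h1]

theorem iterate_push_invariant {Q : S → S → ℝ≥0∞} {r : ℝ≥0∞} {v : S → ℝ≥0∞}
    (hv : ∀ z, r * push Q v z = v z) (n : ℕ) (z : S) : r ^ n * (push Q)^[n] v z = v z := by
  have hfix : push (fun y z => r * Q y z) v = v := by
    rw [push_scaled]
    exact funext hv
  have := congrFun (Function.iterate_fixed hfix n) z
  rwa [iterate_push_scaled] at this

/-- Time `n = 1` already gives the eigenvector equation; iterating it gives both the survival
probabilities and the conditional laws at all times. -/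
theorem isMinimalQSD_iff [Countable S] (p : Option S → PMF (Option S)) (ν : PMF S) :
    IsMinimalQSD p ν ↔ ∀ z, ENNReal.ofReal (Real.exp (critParam p)) *
      push (subKernel p Set.univ) ν z = ν z := by
  set R := ENNReal.ofReal (Real.exp (critParam p)) with hR
  have hR0 : R ≠ 0 := (ENNReal.ofReal_pos.2 (Real.exp_pos _)).ne'
  have hRtop : R ≠ ∞ := ENNReal.ofReal_ne_top
  have hexp : ∀ n : ℕ, ENNReal.ofReal (Real.exp (-critParam p * n)) = (R ^ n)⁻¹ := fun n => by
    rw [hR, ← ENNReal.ofReal_pow (Real.exp_pos _).le,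
      ← ENNReal.ofReal_inv_of_pos (pow_pos (Real.exp_pos _) n), ← Real.exp_nat_mul,
      ← Real.exp_neg]
    congr 2
    ring
  constructor
  · rintro ⟨hq, ha⟩ z
    have h1 := ha 1
    rw [initLaw_coe_lt_absTime, hexp, pow_one] at h1
    have h2 := congrArg (fun m : Measure (Option S) => m {some z}) (hq 1 le_rfl)
    simp only [condLaw_apply, toMeasure_map_some_apply] at h2
    rw [h1, inv_inv] at h2
    have h3 : (some ⁻¹' {some z} : Set S) = {z} := by ext; simp
    rw [h3, tsum_eq_single z fun b hb => by simp [hb],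
      tsum_eq_single z fun b hb => by simp [hb]] at h2
    simpa using h2
  · intro h
    have hn := iterate_push_invariant h
    have hR0n : ∀ n, R ^ n ≠ 0 := fun n => pow_ne_zero n hR0
    have hRtopn : ∀ n, R ^ n ≠ ∞ := fun n => ENNReal.pow_ne_top hRtop
    have hsum : ∀ n, ∑' z, (push (subKernel p Set.univ))^[n] ν z = (R ^ n)⁻¹ := fun n => by
      refine ENNReal.eq_inv_of_mul_eq_one_left ?_
      rw [mul_comm, ← ENNReal.tsum_mul_left]
      simp_rw [hn]
      exact ν.tsum_coe
    refine ⟨fun n _ => Measure.ext fun A _ => ?_, fun n => ?_⟩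
    · rw [condLaw_apply, toMeasure_map_some_apply, hsum, inv_inv, ← ENNReal.tsum_mul_left]
      refine tsum_congr fun z => ?_
      by_cases hz : some z ∈ A <;> simp [hz, hn]
    · rw [initLaw_coe_lt_absTime, hsum, hexp]

theorem ne_zero_of_invariant {Q : S → S → ℝ≥0∞} {r : ℝ≥0∞} (hr : r ≠ 0)
    (hirr : ∀ x y, ∃ n, 0 < (push Q)^[n] (PMF.pure x) y) {v : S → ℝ≥0∞}
    (hv : ∀ z, r * push Q v z = v z) {x : S} (hx : v x ≠ 0) (y : S) : v y ≠ 0 := by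
  obtain ⟨n, hn⟩ := hirr x y
  rw [← iterate_push_invariant hv n y]
  refine mul_ne_zero (pow_ne_zero n hr) (ne_of_gt ?_)
  exact (ENNReal.mul_pos hx hn.ne').trans_le (smul_iterate_push_pure_le Q n v x y)

/-- An invariant vector that dominates another one and agrees with it at one point is equal
to it. -/
theorem eq_of_invariant_of_le {Q : S → S → ℝ≥0∞} {r : ℝ≥0∞} (hr : r ≠ 0)
    (hirr : ∀ x y, ∃ n, 0 < (push Q)^[n] (PMF.pure x) y) {v w : S → ℝ≥0∞}
    (hv : ∀ z, r * push Q v z = v z) (hw : ∀ z, r * push Q w z = w z) (hwv : w ≤ v) {x : S}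
    (hx : w x = v x) (hxtop : v x ≠ ∞) : w = v := by
  have hvD : v = w + (v - w) := (add_tsub_cancel_of_le hwv).symm
  have hD : v - w = 0 := by
    ext z
    -- An excess of `v` over `w` at `z` would be carried to `x`, where there is none.
    obtain ⟨n, hn⟩ := hirr z x
    have h1 : v x = v x + r ^ n * (push Q)^[n] (v - w) x := by
      conv_lhs => rw [← iterate_push_invariant hv n x, hvD, iterate_push_add, Pi.add_apply, mul_add,
        iterate_push_invariant hw n x, hx]
    have h2 : r ^ n * (push Q)^[n] (v - w) x = 0 := by
      have h3 : v x + 0 = v x + r ^ n * (push Q)^[n] (v - w) x := by rwa [add_zero]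
      exact ((ENNReal.add_right_inj hxtop).1 h3).symm
    have h4 : (push Q)^[n] (v - w) x = 0 :=
      (mul_eq_zero.1 h2).resolve_left (pow_ne_zero n hr)
    have h5 : (v - w) z * (push Q)^[n] (PMF.pure z) x ≤ 0 :=
      (smul_iterate_push_pure_le Q n (v - w) z x).trans h4.le
    exact (mul_eq_zero.1 (le_zero_iff.1 h5)).resolve_right hn.ne'
  rw [hvD, hD, add_zero]

theorem tsum_green_compl_ne_top (p : Option S → PMF (Option S)) {r : ℝ≥0∞} {ν : PMF S}
    (hν : ∀ z, r * push (subKernel p Set.univ) ν z = ν z) {x : S} (hx : ν x ≠ 0) :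
    ∑' z, green (subKernel p {x}ᶜ) r (PMF.pure x) z ≠ ∞ := by
  intro h
  have h1 := ENNReal.tsum_le_tsum (smul_green_compl_le p (x := x) fun z => (hν z).le)
  simp only [Pi.smul_apply, smul_eq_mul] at h1
  rw [ENNReal.tsum_mul_left, h, ν.tsum_coe, ENNReal.mul_top hx] at h1
  simp at h1

theorem green_compl_invariant (p : Option S → PMF (Option S)) {r : ℝ≥0∞} {x : S}
    (hF : returnSum p (fun n => r ^ n) x = 1) (z : S) :
    r * push (subKernel p Set.univ) (green (subKernel p {x}ᶜ) r (PMF.pure x)) z =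
      green (subKernel p {x}ᶜ) r (PMF.pure x) z := by
  by_cases hz : z = x
  · subst hz
    rw [mul_push_green_compl_self, hF, green_compl_self]
  · exact mul_push_green_compl_of_ne p r hz

theorem smul_green_compl_eq (p : Option S → PMF (Option S)) {r : ℝ≥0∞} (hr : r ≠ 0)
    (hirr : ∀ x y, ∃ n, 0 < (push (subKernel p Set.univ))^[n] (PMF.pure x) y) {ν : PMF S}
    (hν : ∀ z, r * push (subKernel p Set.univ) ν z = ν z) {x : S}
    (hF : returnSum p (fun n => r ^ n) x = 1) :
    ν x • green (subKernel p {x}ᶜ) r (PMF.pure x) = ⇑ν := by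
  refine eq_of_invariant_of_le hr hirr hν (fun z => ?_)
    (smul_green_compl_le p fun z => (hν z).le) (x := x) ?_ (PMF.apply_ne_top ν x)
  · rw [push_smul, Pi.smul_apply, smul_eq_mul, mul_left_comm, green_compl_invariant p hF]
    rfl
  · simp [green_compl_self]

theorem exists_pmf_invariant (p : Option S → PMF (Option S)) {r : ℝ≥0∞} {x : S}
    (hF : returnSum p (fun n => r ^ n) x = 1)
    (hM : ∑' z, green (subKernel p {x}ᶜ) r (PMF.pure x) z ≠ ∞) :
    ∃ ν : PMF S, ∀ z, r * push (subKernel p Set.univ) ν z = ν z := by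
  set G := green (subKernel p {x}ᶜ) r (PMF.pure x) with hG
  have h0 : ∑' z, G z ≠ 0 := fun h => by
    have := ENNReal.tsum_eq_zero.1 h x
    rw [hG, green_compl_self] at this
    exact one_ne_zero this
  refine ⟨PMF.normalize G h0 hM, fun z => ?_⟩
  have hcoe : ⇑(PMF.normalize G h0 hM) = (∑' z, G z)⁻¹ • G := by
    ext z
    rw [PMF.normalize_apply, mul_comm]
    rfl
  rw [hcoe, push_smul, Pi.smul_apply, smul_eq_mul, mul_left_comm, green_compl_invariant p hF]
  rfl

theorem stoppedMoment_ne_top_iff [Countable S] (p : Option S → PMF (Option S))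
    (hl : 0 < critParam p) (x : S) : stoppedMoment p x ≠ ∞ ↔
      ∑' z, green (subKernel p {x}ᶜ) (ENNReal.ofReal (Real.exp (critParam p)))
        (PMF.pure x) z ≠ ∞ := by
  have hd : ENNReal.ofReal (Real.exp (critParam p) - 1) ≠ 0 := by simpa using hl
  rw [stoppedMoment_eq p hl]
  constructor
  · intro h h'
    rw [h', ENNReal.mul_top hd, add_top] at h
    exact h rfl
  · exact fun h => ENNReal.add_ne_top.2
      ⟨ENNReal.one_ne_top, ENNReal.mul_ne_top ENNReal.ofReal_ne_top h⟩

/-- The stopped moment is both `1 + (R - 1) ∑ G` and `absFirstMoment + F`; with `F = 1` the ones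
cancel. -/
theorem absFirstMoment_eq [Countable S] (p : Option S → PMF (Option S))
    (hl : 0 < critParam p) {x : S}
    (hF : returnSum p (fun n => ENNReal.ofReal (Real.exp (critParam p)) ^ n) x = 1)
    (hM : ∑' z, green (subKernel p {x}ᶜ) (ENNReal.ofReal (Real.exp (critParam p)))
      (PMF.pure x) z ≠ ∞) :
    absFirstMoment p x = ENNReal.ofReal (Real.exp (critParam p) - 1) *
      ∑' z, green (subKernel p {x}ᶜ) (ENNReal.ofReal (Real.exp (critParam p)))
        (PMF.pure x) z := by
  have h := stoppedMoment_eq_add p hl x ((stoppedMoment_ne_top_iff p hl x).2 hM).lt_top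
  rw [stoppedMoment_eq p hl, hF, add_comm] at h
  exact ((ENNReal.add_left_inj ENNReal.one_ne_top).1 h).symm

theorem IsMinimalQSD.absFirstMoment_formula [Countable S] {p : Option S → PMF (Option S)}
    (habs : p none = PMF.pure none) (hirr : IsIrreducible p) (hmom : HasExpMoment p)
    (hinf : InfiniteMGF p) {ν : PMF S} (hν : IsMinimalQSD p ν) (x : S) :
    ν x ≠ 0 ∧ stoppedMoment p x ≠ ∞ ∧
      returnSum p (fun n => ENNReal.ofReal (Real.exp (critParam p)) ^ n) x = 1 ∧
      absFirstMoment p x ≠ 0 ∧ absFirstMoment p x ≠ ∞ ∧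
      ν x = ENNReal.ofReal (Real.exp (critParam p) - 1) / absFirstMoment p x := by
  have hl := critParam_pos p hinf
  have hR0 : ENNReal.ofReal (Real.exp (critParam p)) ≠ 0 :=
    (ENNReal.ofReal_pos.2 (Real.exp_pos _)).ne'
  have hd : ENNReal.ofReal (Real.exp (critParam p) - 1) ≠ 0 := by simpa using hl
  have hirrQ := hirr.exists_iterate_push_pos habs
  have hinv := (isMinimalQSD_iff p ν).1 hν
  obtain ⟨y, hy⟩ := ν.support_nonempty
  have hx : ν x ≠ 0 := ne_zero_of_invariant hR0 hirrQ hinv ((ν.mem_support_iff y).1 hy) x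
  have hM := tsum_green_compl_ne_top p hinv hx
  have hF := returnSum_critParam_eq_one habs hirr hmom hinf hM
  have hA := absFirstMoment_eq p hl hF hM
  have hsum := congrArg (fun v : S → ℝ≥0∞ => ∑' z, v z) (smul_green_compl_eq p hR0 hirrQ hinv hF)
  simp only [Pi.smul_apply, smul_eq_mul] at hsum
  rw [ENNReal.tsum_mul_left, ν.tsum_coe] at hsum
  have hM0 : ∑' z, green (subKernel p {x}ᶜ) (ENNReal.ofReal (Real.exp (critParam p)))
      (PMF.pure x) z ≠ 0 := fun h => by simp [h] at hsum
  refine ⟨hx, (stoppedMoment_ne_top_iff p hl x).2 hM, hF, ?_, ?_, ?_⟩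
  · rw [hA]
    exact mul_ne_zero hd hM0
  · rw [hA]
    exact ENNReal.mul_ne_top ENNReal.ofReal_ne_top hM
  · rw [hA, ENNReal.eq_div_iff (mul_ne_zero hd hM0)
      (ENNReal.mul_ne_top ENNReal.ofReal_ne_top hM), mul_assoc, mul_comm _ (ν x), hsum, mul_one]

theorem exists_isMinimalQSD [Countable S] {p : Option S → PMF (Option S)}
    (habs : p none = PMF.pure none) (hirr : IsIrreducible p) (hmom : HasExpMoment p)
    (hinf : InfiniteMGF p) {x : S} (hx : stoppedMoment p x < ∞) :
    ∃ ν : PMF S, IsMinimalQSD p ν := by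
  have hM := (stoppedMoment_ne_top_iff p (critParam_pos p hinf) x).1 hx.ne
  obtain ⟨ν, hν⟩ := exists_pmf_invariant p
    (returnSum_critParam_eq_one habs hirr hmom hinf hM) hM
  exact ⟨ν, (isMinimalQSD_iff p ν).2 hν⟩

/-! ### The harmonic function `y ↦ E_y[r ^ τ_x, τ_x < τ_Δ]` -/

/-- `E_y[r ^ τ_x, τ_x < τ_Δ]` as a function of `y`. -/
noncomputable def hitVec (p : Option S → PMF (Option S)) (r : ℝ≥0∞) (x : S) : S → ℝ≥0∞ :=
  green (fun z y => subKernel p {x}ᶜ y z) r fun y => r * subKernel p Set.univ y x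

/-- Duality: functions are moved by pushing with the transposed kernel, which is why `hitVec` is
itself a Green vector. -/
theorem tsum_push_mul_eq (K : S → S → ℝ≥0∞) (v f : S → ℝ≥0∞) :
    ∑' z, push K v z * f z = ∑' y, v y * push (fun z y => K y z) f y := by
  simp only [push, ← ENNReal.tsum_mul_right, ← ENNReal.tsum_mul_left]
  rw [ENNReal.tsum_comm]
  exact tsum_congr fun y => tsum_congr fun z => by ring

theorem tsum_iterate_push_mul_eq (K : S → S → ℝ≥0∞) (n : ℕ) (v f : S → ℝ≥0∞) :
    ∑' z, (push K)^[n] v z * f z = ∑' y, v y * (push fun z y => K y z)^[n] f y := by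
  induction n generalizing v with
  | zero => rfl
  | succ n ih =>
    rw [Function.iterate_succ_apply, ih, tsum_push_mul_eq, Function.iterate_succ_apply']

theorem tsum_mul_hitVec (p : Option S → PMF (Option S)) (r : ℝ≥0∞) (x : S) (v : S → ℝ≥0∞) :
    ∑' y, v y * hitVec p r x y = ∑' n : ℕ, r ^ (n + 1) *
      push (subKernel p Set.univ) ((push (subKernel p {x}ᶜ))^[n] v) x := by
  simp only [hitVec, green, ← ENNReal.tsum_mul_left]
  rw [ENNReal.tsum_comm]
  refine tsum_congr fun n => ?_
  simp_rw [mul_left_comm _ (r ^ n)]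
  rw [ENNReal.tsum_mul_left, ← tsum_iterate_push_mul_eq, pow_succ, mul_assoc, push]
  congr 1
  rw [← ENNReal.tsum_mul_left]
  exact tsum_congr fun y => by ring

theorem hitVec_self (p : Option S → PMF (Option S)) (r : ℝ≥0∞) (x : S) :
    hitVec p r x x = returnSum p (fun n => r ^ n) x := by
  rw [returnSum, ← tsum_mul_hitVec p r x (PMF.pure x), tsum_eq_single x]
  · simp
  · intro y hy
    simp [PMF.pure_apply, hy]

/-- First-step analysis gives a step into `x` the weight `1` rather than `hitVec p r x x`; these
agree exactly because `F = 1`. -/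
theorem tsum_mul_hitVec_of_returnSum_eq_one (p : Option S → PMF (Option S)) {r : ℝ≥0∞} {x : S}
    (hF : returnSum p (fun n => r ^ n) x = 1) (y : S) :
    ∑' z, r * subKernel p Set.univ y z * hitVec p r x z = hitVec p r x y := by
  conv_rhs => rw [hitVec, green_eq_add, ← hitVec]
  rw [ENNReal.tsum_eq_add_tsum_ite x, hitVec_self, hF, mul_one, Pi.add_apply, Pi.smul_apply,
    smul_eq_mul, push, ← ENNReal.tsum_mul_left]
  congr 1
  refine tsum_congr fun z => ?_
  by_cases hz : z = x
  · simp [hz, subKernel]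
  · simp only [hz, if_false, subKernel, Set.indicator_univ, Set.mem_compl_iff,
      Set.mem_singleton_iff, not_false_eq_true, Set.indicator_of_mem]
    ring

theorem tsum_tsum_add (φ : ℕ → ℝ≥0∞) :
    ∑' m : ℕ, ∑' n : ℕ, φ (m + n) = ∑' k : ℕ, (k + 1) * φ k := by
  rw [← ENNReal.tsum_prod (f := fun m n => φ (m + n)),
    ← (Finset.HasAntidiagonal.sigmaAntidiagonalEquivProd (A := ℕ)).tsum_eq, ENNReal.tsum_sigma']
  refine tsum_congr fun k => ?_
  rw [tsum_fintype]
  rw [Finset.sum_congr rfl (g := fun _ => φ k) fun b _ => congrArg φ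
    (Finset.HasAntidiagonal.mem_antidiagonal.1 b.2)]
  simp

/-- Cutting an excursion of length `k + 1` at each of the times `0, …, k` counts it `k + 1` times,
which produces the factor `τ_x`. -/
theorem tsum_green_mul_hitVec (p : Option S → PMF (Option S)) (r : ℝ≥0∞) (x : S) :
    ∑' y, green (subKernel p {x}ᶜ) r (PMF.pure x) y * hitVec p r x y =
      returnSum p (fun n => r ^ n * n) x := by
  set φ : ℕ → ℝ≥0∞ := fun k => r ^ (k + 1) *
    push (subKernel p Set.univ) ((push (subKernel p {x}ᶜ))^[k] (PMF.pure x)) x with hφ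
  have h1 : ∑' y, green (subKernel p {x}ᶜ) r (PMF.pure x) y * hitVec p r x y =
      ∑' m : ℕ, ∑' n : ℕ, φ (m + n) := by
    simp only [green, ← ENNReal.tsum_mul_right]
    rw [ENNReal.tsum_comm]
    refine tsum_congr fun m => ?_
    simp_rw [mul_assoc]
    rw [ENNReal.tsum_mul_left, tsum_mul_hitVec, ← ENNReal.tsum_mul_left]
    refine tsum_congr fun n => ?_
    simp only [hφ]
    rw [← Function.iterate_add_apply, add_comm n m]
    ring
  rw [h1, tsum_tsum_add, returnSum]
  refine tsum_congr fun k => ?_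
  simp only [hφ]
  push_cast
  ring

/-! ### Aperiodicity -/

theorem IsAperiodic.exists_forall_ge_iterate_push_pos [Countable S]
    {p : Option S → PMF (Option S)} (habs : p none = PMF.pure none) (hap : IsAperiodic p) (x : S) :
    ∃ N, ∀ n ≥ N, 0 < (push (subKernel p Set.univ))^[n] (PMF.pure x) x := by
  set s : Set ℕ := {n | 1 ≤ n ∧ 0 < pointLaw p x {ω | ω n = some x}} with hs
  have hgcd : Nat.setGcd s = 1 := hap x _ fun n h1 h2 => Nat.setGcd_dvd_of_mem ⟨h1, h2⟩
  obtain ⟨N, hN⟩ := Nat.exists_mem_closure_of_ge s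
  refine ⟨N, fun n hn => ?_⟩
  -- The additive monoid generated by the return times contains all large multiples of their gcd,
  -- here `1`; positivity of return is stable under addition.
  have hmem := hN n hn (hgcd ▸ one_dvd n)
  clear hn
  induction hmem using AddSubmonoid.closure_induction with
  | mem m hm =>
    have h := hm.2
    rwa [pointLaw_eq_initLaw, initLaw_coord p habs] at h
  | zero => simp
  | add m n _ _ h1 h2 => exact iterate_push_pos_add h1 h2

theorem exists_common_iterate_push_pos [Countable S] {p : Option S → PMF (Option S)}
    (habs : p none = PMF.pure none) (hirr : IsIrreducible p) (hap : IsAperiodic p) (a b : S) :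
    ∃ (j : ℕ) (z : S), 0 < (push (subKernel p Set.univ))^[j] (PMF.pure a) z ∧
      0 < (push (subKernel p Set.univ))^[j] (PMF.pure b) z := by
  obtain ⟨N, hN⟩ := hap.exists_forall_ge_iterate_push_pos habs a
  obtain ⟨n, hn⟩ := hirr.exists_iterate_push_pos habs b a
  refine ⟨n + N, a, hN _ (by omega), iterate_push_pos_add hn (hN _ le_rfl)⟩

/-! ### The quasi-limiting distribution -/

theorem IsMinimalQSD.isQuasiLimiting [Countable S] {p : Option S → PMF (Option S)}
    (habs : p none = PMF.pure none) (hirr : IsIrreducible p) (hmom : HasExpMoment p)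
    (hinf : InfiniteMGF p) (hap : IsAperiodic p) {ν : PMF S} (hν : IsMinimalQSD p ν) {x : S}
    (hx : returnFirstMoment p x < ∞) {μ : PMF S} (hμ : μ.support.Finite) :
    IsQuasiLimiting p μ ν := by
  have hform := fun y => hν.absFirstMoment_formula habs hirr hmom hinf y
  have hinv := (isMinimalQSD_iff p ν).1 hν
  have hF := (hform x).2.2.1
  rw [returnFirstMoment_eq] at hx
  have hirrQ := hirr.exists_iterate_push_pos habs
  set R := ENNReal.ofReal (Real.exp (critParam p)) with hR
  have hR0 : R ≠ 0 := (ENNReal.ofReal_pos.2 (Real.exp_pos _)).ne'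
  have hRn0 : ∀ n, R ^ n ≠ 0 := fun n => pow_ne_zero n hR0
  have hRntop : ∀ n, R ^ n ≠ ∞ := fun n => ENNReal.pow_ne_top ENNReal.ofReal_ne_top
  set Q := subKernel p Set.univ with hQ
  set K : S → S → ℝ≥0∞ := fun y z => R * Q y z with hK
  set h := hitVec p R x with hh
  have hKiter : ∀ (n : ℕ) (v : S → ℝ≥0∞), (push K)^[n] v = R ^ n • (push Q)^[n] v :=
    iterate_push_scaled Q R
  have hKpos : ∀ {n : ℕ} {v : S → ℝ≥0∞} {z : S}, 0 < (push Q)^[n] v z → 0 < (push K)^[n] v z := by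
    intro n v z hpos
    rw [hKiter]
    exact ENNReal.mul_pos (hRn0 n) hpos.ne'
  have hν0 : ∀ z, ν z ≠ 0 := fun z => (hform z).1
  have hKν : push K ν = ν := by
    rw [hK, push_scaled]
    exact funext hinv
  have hKh : ∀ y, ∑' z, K y z * h z = h y := tsum_mul_hitVec_of_returnSum_eq_one p hF
  have hsum : ∑' z, ν z * h z ≠ ∞ := by
    rw [← smul_green_compl_eq p hR0 hirrQ hinv hF]
    simp only [Pi.smul_apply, smul_eq_mul, mul_assoc]
    rw [ENNReal.tsum_mul_left, tsum_green_mul_hitVec]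
    exact ENNReal.mul_ne_top (PMF.apply_ne_top ν x) hx.ne
  have htop : ∀ y, h y ≠ ∞ := fun y hy =>
    ENNReal.ne_top_of_tsum_ne_top hsum y (by rw [hy, ENNReal.mul_top (hν0 y)])
  have h0 : ∀ y, h y ≠ 0 := fun y hy => by
    obtain ⟨n, hn⟩ := hirrQ y x
    have h1 := tsum_iterate_push_mul hKh n (PMF.pure y)
    rw [tsum_eq_single (f := fun z => (PMF.pure y) z * h z) y fun z hz => by
      simp [PMF.pure_apply, hz], hy, mul_zero, ENNReal.tsum_eq_zero] at h1
    refine mul_ne_zero (hKpos hn).ne' ?_ (h1 x)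
    rw [hh, hitVec_self, hF]
    exact one_ne_zero
  -- Finite support enters here: `ν` is positive everywhere, so finitely many reciprocals give a
  -- finite `c`.
  obtain ⟨c, hc, hμc⟩ : ∃ c : ℝ≥0∞, c ≠ ∞ ∧ ⇑μ ≤ c • ⇑ν := by
    refine ⟨∑ z ∈ hμ.toFinset, (ν z)⁻¹,
      ENNReal.sum_ne_top.2 fun z _ => ENNReal.inv_ne_top.2 (hν0 z), fun z => ?_⟩
    by_cases hz : z ∈ μ.support
    · calc μ z ≤ 1 := μ.coe_le_one z
        _ = (ν z)⁻¹ * ν z := (ENNReal.inv_mul_cancel (hν0 z) (PMF.apply_ne_top ν z)).symm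
        _ ≤ _ := mul_le_mul_left (Finset.single_le_sum (f := fun z => (ν z)⁻¹)
          (fun _ _ => zero_le) (hμ.mem_toFinset.2 hz)) _
    · rw [(PMF.apply_eq_zero_iff μ z).2 hz]
      exact zero_le
  have hlim := tendsto_iterate_push hν0 (PMF.apply_ne_top ν) h0 htop hKν hKh hsum
    (fun a b => by
      obtain ⟨j, z, h1, h2⟩ := exists_common_iterate_push_pos habs hirr hap a b
      exact ⟨j, z, hKpos h1, hKpos h2⟩) hc hμc
  set κ := (∑' y, μ y * h y) / ∑' y, ν y * h y with hκ
  have hDtop : ∑' y, μ y * h y ≠ ∞ := by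
    refine ne_top_of_le_ne_top (ENNReal.mul_ne_top hc hsum) ?_
    rw [← ENNReal.tsum_mul_left]
    simp_rw [← mul_assoc]
    exact ENNReal.tsum_le_tsum fun y => mul_le_mul_left (hμc y) _
  have hκ0 : κ ≠ 0 := by
    refine ENNReal.div_ne_zero.2 ⟨fun hD => ?_, hsum⟩
    obtain ⟨y, hy⟩ := μ.support_nonempty
    exact mul_ne_zero ((μ.mem_support_iff y).1 hy) (h0 y) (ENNReal.tsum_eq_zero.1 hD y)
  have hκtop : κ ≠ ∞ := ENNReal.div_ne_top hDtop fun hN =>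
    mul_ne_zero (hν0 x) (h0 x) (ENNReal.tsum_eq_zero.1 hN x)
  have hle : ∀ n, (push K)^[n] μ ≤ c • ⇑ν := fun n => by
    refine (iterate_push_mono K n hμc).trans ?_
    rw [iterate_push_smul, Function.iterate_fixed hKν n]
  have hsumlim : ∀ B : Set S, Tendsto (fun n => ∑' z, B.indicator ((push K)^[n] μ) z) atTop
      (𝓝 (κ * ∑' z, B.indicator ν z)) := fun B => by
    rw [← ENNReal.tsum_mul_left]
    refine tendsto_tsum_of_dominated (bound := c • ⇑ν)
      (fun n z => (Set.indicator_le_self _ _ z).trans (hle n z)) ?_ fun z => ?_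
    · simp only [Pi.smul_apply, smul_eq_mul]
      rw [ENNReal.tsum_mul_left, ν.tsum_coe, mul_one]
      exact hc
    · by_cases hz : z ∈ B
      · simpa [hz] using hlim z
      · simp [hz]
  intro A
  -- The factor `R ^ n` cancels between numerator and denominator, so `K` can replace `Q`.
  have heq : ∀ n, condLaw p μ n A = (∑' z, Set.univ.indicator ((push K)^[n] μ) z)⁻¹ *
      ∑' z, (some ⁻¹' A).indicator ((push K)^[n] μ) z := fun n => by
    have hind : ∀ B : Set S, ∑' z, B.indicator ((push K)^[n] μ) z =
        R ^ n * ∑' z, B.indicator ((push Q)^[n] μ) z := fun B => by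
      rw [← ENNReal.tsum_mul_left]
      refine tsum_congr fun z => ?_
      by_cases hz : z ∈ B <;> simp [hz, hKiter]
    rw [condLaw_apply, hind, hind, ENNReal.mul_inv (Or.inl (hRn0 n)) (Or.inl (hRntop n)),
      mul_mul_mul_comm, ENNReal.inv_mul_cancel (hRn0 n) (hRntop n), one_mul, Set.indicator_univ]
  have huniv : κ * ∑' z, (Set.univ : Set S).indicator ν z = κ := by
    rw [Set.indicator_univ, ν.tsum_coe, mul_one]
  have hT := hsumlim Set.univ
  rw [huniv] at hT
  have hmul := ENNReal.Tendsto.mul (tendsto_inv_iff.2 hT) (Or.inl (ENNReal.inv_ne_zero.2 hκtop))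
    (hsumlim (some ⁻¹' A)) (Or.inr (ENNReal.inv_ne_top.2 hκ0))
  rw [← mul_assoc, ENNReal.inv_mul_cancel hκ0 hκtop, one_mul] at hmul
  simp_rw [heq]
  rwa [toMeasure_map_some_apply]

end QSD

theorem mainTheorem1 {S : Type*} [Countable S] (p : Option S → PMF (Option S))
    (habs : p none = PMF.pure none)
    (hirr : QSD.IsIrreducible p) (hmom : QSD.HasExpMoment p)
    (hinf : QSD.InfiniteMGF p) :
    ((∃ ν : PMF S, QSD.IsMinimalQSD p ν) ↔ ∃ x : S, QSD.stoppedMoment p x < ∞) ∧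
    ((∃ x : S, QSD.stoppedMoment p x < ∞) →
      ∃ νcr : PMF S,
        (∀ x : S, QSD.absFirstMoment p x ≠ 0 ∧ QSD.absFirstMoment p x ≠ ∞ ∧
          νcr x = ENNReal.ofReal (Real.exp (QSD.critParam p) - 1) / QSD.absFirstMoment p x) ∧
        (∀ ν : PMF S, QSD.IsMinimalQSD p ν ↔ ν = νcr) ∧
        ((∃ x : S, QSD.returnFirstMoment p x < ∞) → QSD.IsAperiodic p →
          ∀ μ : PMF S, μ.support.Finite → QSD.IsQuasiLimiting p μ νcr)) := by
  have hform : ∀ {ν : PMF S}, QSD.IsMinimalQSD p ν → ∀ x, _ := fun hν x =>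
    hν.absFirstMoment_formula habs hirr hmom hinf x
  refine ⟨⟨?_, ?_⟩, ?_⟩
  · rintro ⟨ν, hν⟩
    obtain ⟨x, -⟩ := ν.support_nonempty
    exact ⟨x, (hform hν x).2.1.lt_top⟩
  · rintro ⟨x, hx⟩
    exact QSD.exists_isMinimalQSD habs hirr hmom hinf hx
  · rintro ⟨x, hx⟩
    obtain ⟨νcr, hcr⟩ := QSD.exists_isMinimalQSD habs hirr hmom hinf hx
    refine ⟨νcr, fun x => (hform hcr x).2.2.2, fun ν => ⟨fun hν => PMF.ext fun x => ?_, ?_⟩, ?_⟩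
    · rw [(hform hν x).2.2.2.2.2, (hform hcr x).2.2.2.2.2]
    · rintro rfl
      exact hcr
    · rintro ⟨y, hy⟩ hap μ hμ
      exact hcr.isQuasiLimiting habs hirr hmom hinf hap hy hμ
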